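/- **Setting.** Let $\mathcal G=(\mathcal N,\mathcal E)$, $\mathcal N=\{1,\dots,N\}$, be a connected undirected graph with Laplacian $\Omega$, let $\mathcal N_i$ be the set of neighbours of $i$, and let $W\in\mathbb R^{N\times N}$ be a communication matrix: for every $i$, $W_{ij}=0$ if $j\notin\mathcal N_i\cup\{i\}$, $W_{ij}<0$ if $j\in\mathcal N_i$, and $W_{ii}=-\sum_{j\in\mathcal N_i}W_{ij}$ ($W$ need not be symmetric). Let $\omega_i$ be the $i$-th column of $W$, and let $\sigma_{\min}(W)$ be the smallest nonzero singular value of $W$ (for $N=1$, where there is none, read $a/\sigma_{\min}^2(W)$ as $0$). For $A\in\mathbb R^{N\times N}$ and $\mathbf x=[x_i]_i\in\mathbb R^{nN}$, $(A\otimes I_n)\mathbf x=[\sum_jA_{ij}x_j]_i$. All norms are Euclidean. For each $i$ let $\xi_i:\mathbb R^n\to\mathbb R\cup\{+\infty\}$ be closed convex and $f_i:\mathbb R^n\to\mathbb R$ convex, differentiable on an open set $U_i\supseteq\operatorname{dom}\xi_i$, with $\nabla f_i$ Lipschitz on $U_i$ with constant $L_i\ge0$. Put $\Phi_i=\xi_i+f_i$,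 $F(\mathbf x)=\sum_i\Phi_i(x_i)$ and $F^*=\inf_{x\in\mathbb R^n}\sum_i\Phi_i(x)$. Assume that $x^*\in\mathbb R^n$ attains $F^*$, that $\operatorname{ri}\big(\bigcap_i\operatorname{dom}\xi_i\big)\ne\emptyset$, and that at least one of the following holds: the Lagrangian $(\mathbf x,\mathbf p)\mapsto F(\mathbf x)+\mathbf p^\top(W\otimes I_n)\mathbf x$ has a saddle point, or $\bigcap_i\operatorname{ri}(\operatorname{dom}\xi_i)\neq\emptyset$. **Algorithm DPGA-W.** Let $\gamma_i>0$, let $c_i>0$ with $c_i(L_i+\gamma_i\|\omega_i\|^2)\le1$, and let $x_i^0$ be any points such that for every $y\in\operatorname{dom}\xi_i$ the segment $[x_i^0,y]$ lies in $U_i$ (no restriction if $U_i=\mathbb R^n$; automatic if $x_i^0\in\operatorname{dom}\xi_i$). Start with $p_i^0=s_i^0=0$ and for $k\ge0$ let $$x_i^{k+1}=\operatorname{prox}_{c_i\xi_i}\Big(x_i^k-c_i\big(\nabla f_i(x_i^k)+\sum_{j\in\mathcal N_i\cup\{i\}}W_{ji}(p_j^k+s_j^k)\big)\Big),$$ $$s_i^{k+1}=\Big(\sum_{j\in\mathcal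 N_i\cup\{i\}}\tfrac1{\gamma_j}\Big)^{-1}\sum_{j\in\mathcal N_i\cup\{i\}}W_{ij}x_j^{k+1},\qquad p_i^{k+1}=p_i^k+s_i^{k+1},$$ where $\operatorname{prox}_{c\xi}(z)=\operatorname{argmin}_u\{c\,\xi(u)+\frac12\|u-z\|^2\}$. Put $\bar x_i^t=\frac1t\sum_{k=1}^tx_i^k$ and $\tau_{\max}=\max_i\sum_{j\in\mathcal N_i\cup\{i\}}\frac1{\gamma_j}$. **Theorem.** 1. If $c_i(L_i+\gamma_i\|\omega_i\|^2)<1$ for all $i$, then $\{\mathbf x^k\}$ converges to an optimal solution of $\min\{F(\mathbf x): x_i=x_j\ \forall (i,j)\in\mathcal E\}$. 2. For all $t\ge1$, $\displaystyle F(\bar{\mathbf x}^t)-F^*\le\frac1t\sum_i\frac1{2c_i}\|x_i^0-x^*\|^2.$ 3. If $\kappa_i$ are such that $\|q\|\le\kappa_i$ for all $q\in\partial\Phi_i(x^*)$ and all $i$, then for all $t\ge1$ $$F(\bar{\mathbf x}^t)-F^*\ge-\frac1t\Big(\frac{2\tau_{\max}}{\sigma_{\min}^2(W)}\sum_i\kappa_i^2+\sum_i\frac1{2c_i}\|x_i^0-x^*\|^2\Big),$$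 $$\|(W\otimes I_n)\bar{\mathbf x}^t\|\le\frac1t\Big(\tau_{\max}\Big(\sum_i\frac{\kappa_i^2}{\sigma_{\min}^2(W)}+1\Big)+\sum_i\frac1{2c_i}\|x_i^0-x^*\|^2\Big).$$ 4. $\|(\Omega\otimes I_n)\bar{\mathbf x}^t\|=O(1/t)$ as $t\to\infty$. -/

import Mathlib

noncomputable section

open scoped BigOperators

namespace DPGAW

/-- The space `ℝⁿ` with its Euclidean norm. -/
abbrev Vec (n : ℕ) : Type := EuclideanSpace ℝ (Fin n)

variable {n N : ℕ}

/-! ### Extended-real-valued convex functions -/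

/-- The effective domain of an extended-real-valued function. -/
def dom (ξ : Vec n → EReal) : Set (Vec n) := {x | ξ x < ⊤}

/-- `ξ : ℝⁿ → ℝ ∪ {+∞}` is a closed (lower semicontinuous) convex function: it does not take the
value `-∞`, it is lower semicontinuous and its epigraph is convex. -/
structure IsClosedConvex (ξ : Vec n → EReal) : Prop where
  ne_bot : ∀ x, ξ x ≠ ⊥
  lsc : LowerSemicontinuous ξ
  convex_epi : Convex ℝ {q : Vec n × ℝ | ξ q.1 ≤ (q.2 : EReal)}

/-- The convex subdifferential of an extended-real-valued function at `x`. -/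
def subdiff (φ : Vec n → EReal) (x : Vec n) : Set (Vec n) :=
  {q | ∀ y, φ x + ((inner ℝ q (y - x) : ℝ) : EReal) ≤ φ y}

/-- `y` is the value at `z` of the prox map of `c ξ`, that is, `y` minimizes
`u ↦ c ξ(u) + ½ ‖u - z‖²` over `ℝⁿ`. -/
def IsProx (c : ℝ) (ξ : Vec n → EReal) (z y : Vec n) : Prop :=
  ∀ u, (c : EReal) * ξ y + ((1 / 2 * ‖y - z‖ ^ 2 : ℝ) : EReal) ≤
    (c : EReal) * ξ u + ((1 / 2 * ‖u - z‖ ^ 2 : ℝ) : EReal)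

/-! ### The network -/

/-- The closed neighbourhood `𝒩ᵢ ∪ {i}`. -/
def closedNbhd (G : SimpleGraph (Fin N)) [DecidableRel G.Adj] (i : Fin N) : Finset (Fin N) :=
  insert i (G.neighborFinset i)

/-- `W` is a communication matrix of the graph `G`. -/
structure IsCommunicationMatrix (G : SimpleGraph (Fin N)) [DecidableRel G.Adj]
    (W : Matrix (Fin N) (Fin N) ℝ) : Prop where
  eq_zero : ∀ i j, j ∉ closedNbhd G i → W i j = 0
  neg : ∀ i j, j ∈ G.neighborFinset i → W i j < 0
  diag : ∀ i, W i i = -∑ j ∈ G.neighborFinset i, W i j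

/-- The squared norm `‖ωᵢ‖²` of the `i`-th column of `W`. -/
def colNormSq (W : Matrix (Fin N) (Fin N) ℝ) (i : Fin N) : ℝ := ∑ j, W j i ^ 2

/-- The smallest nonzero singular value of `W`. -/
def sigmaMin (W : Matrix (Fin N) (Fin N) ℝ) : ℝ :=
  sInf {σ : ℝ | 0 < σ ∧ ∃ k : ℕ, (Matrix.toEuclideanLin W).singularValues k = σ}

/-- `(A ⊗ Iₙ) 𝐱` as an element of `ℝ^{nN}`, with the Euclidean norm. -/
def kronApply (A : Matrix (Fin N) (Fin N) ℝ) (x : Fin N → Vec n) :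
    PiLp 2 (fun _ : Fin N => Vec n) :=
  WithLp.toLp 2 (fun i => ∑ j, A i j • x j)

/-- `τᵢ`, the sum of `1 / γⱼ` over the closed neighbourhood of `i`. -/
def tau (G : SimpleGraph (Fin N)) [DecidableRel G.Adj] (γ : Fin N → ℝ) (i : Fin N) : ℝ :=
  ∑ j ∈ closedNbhd G i, 1 / γ j

/-- `τ_max = maxᵢ τᵢ`. -/
def tauMax (G : SimpleGraph (Fin N)) [DecidableRel G.Adj] (γ : Fin N → ℝ) : ℝ :=
  ⨆ i, tau G γ i

/-! ### The optimization problems -/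

/-- The local cost `Φ = ξ + f`. -/
def localCost (ξ : Vec n → EReal) (f : Vec n → ℝ) (x : Vec n) : EReal := ξ x + (f x : EReal)

/-- `F(𝐱) = ∑ᵢ Φᵢ(xᵢ)`. -/
def totalCost (ξ : Fin N → Vec n → EReal) (f : Fin N → Vec n → ℝ) (x : Fin N → Vec n) : EReal :=
  ∑ i, localCost (ξ i) (f i) (x i)

/-- The objective `x ↦ ∑ᵢ Φᵢ(x)` of the centralized problem. -/
def centralCost (ξ : Fin N → Vec n → EReal) (f : Fin N → Vec n → ℝ) (x : Vec n) : EReal :=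
  totalCost ξ f (fun _ => x)

/-- The optimal value `F*` of the centralized problem. -/
def optValue (ξ : Fin N → Vec n → EReal) (f : Fin N → Vec n → ℝ) : EReal :=
  ⨅ x, centralCost ξ f x

/-- `𝐱` solves the problem of minimizing `F(𝐱)` subject to `xᵢ = xⱼ` for every edge `ij`. -/
def IsConsensusOptimal (G : SimpleGraph (Fin N)) (ξ : Fin N → Vec n → EReal)
    (f : Fin N → Vec n → ℝ) (x : Fin N → Vec n) : Prop :=
  IsMinOn (totalCost ξ f) {z | ∀ i j, G.Adj i j → z i = z j} x ∧ ∀ i j, G.Adj i j → x i = x j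

/-- The Lagrangian `F(𝐱) + ⟨𝐩, (W ⊗ Iₙ) 𝐱⟩` of the problem of minimizing `F(𝐱)` subject to
`(W ⊗ Iₙ) 𝐱 = 0`. -/
def lagrangian (W : Matrix (Fin N) (Fin N) ℝ) (ξ : Fin N → Vec n → EReal)
    (f : Fin N → Vec n → ℝ) (x p : Fin N → Vec n) : EReal :=
  totalCost ξ f x + ((inner ℝ (WithLp.toLp 2 p) (kronApply W x) : ℝ) : EReal)

/-- The Lagrangian has a saddle point (a primal-dual optimal pair). -/
def HasSaddlePoint (W : Matrix (Fin N) (Fin N) ℝ) (ξ : Fin N → Vec n → EReal)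
    (f : Fin N → Vec n → ℝ) : Prop :=
  ∃ x' p' : Fin N → Vec n, ∀ x p : Fin N → Vec n,
    lagrangian W ξ f x' p ≤ lagrangian W ξ f x' p' ∧
      lagrangian W ξ f x' p' ≤ lagrangian W ξ f x p'

/-! ### The algorithm -/

/-- `(x, s, p)` is a run of DPGA-W from `(x⁰, p⁰)`: `x k i`, `s k i`, `p k i` are the vectors
held by agent `i` after `k` iterations.

In the proximal step agent `i` combines the multipliers of its neighbours with the weights
`W j i`, so that this part of the gradient is the `i`-th block of `(W ⊗ Iₙ)ᵀ (p + s)`. For a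
symmetric `W` these are the weights `W i j`. -/
structure IsRun (G : SimpleGraph (Fin N)) [DecidableRel G.Adj] (W : Matrix (Fin N) (Fin N) ℝ)
    (ξ : Fin N → Vec n → EReal) (f : Fin N → Vec n → ℝ) (γ c : Fin N → ℝ)
    (x₀ p₀ : Fin N → Vec n) (x s p : ℕ → Fin N → Vec n) : Prop where
  x_init : ∀ i, x 0 i = x₀ i
  p_init : ∀ i, p 0 i = p₀ i
  s_init : ∀ i, s 0 i = 0
  x_step : ∀ k i, IsProx (c i) (ξ i)
    (x k i - c i • (gradient (f i) (x k i) + ∑ j ∈ closedNbhd G i, W j i • (p k j + s k j)))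
    (x (k + 1) i)
  s_step : ∀ k i, s (k + 1) i =
    (∑ j ∈ closedNbhd G i, 1 / γ j)⁻¹ • ∑ j ∈ closedNbhd G i, W i j • x (k + 1) j
  p_step : ∀ k i, p (k + 1) i = p k i + s (k + 1) i

/-- The ergodic average `x̄ᵢᵗ = (1/t) ∑_{k=1}^t xᵢᵏ`. -/
def avg (x : ℕ → Fin N → Vec n) (t : ℕ) (i : Fin N) : Vec n :=
  (1 / (t : ℝ)) • ∑ k ∈ Finset.Icc 1 t, x k i

/-- `∑ᵢ ‖xᵢ⁰ - x*‖² / (2 cᵢ)`. -/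
def initConst (c : Fin N → ℝ) (x₀ : Fin N → Vec n) (xs : Vec n) : ℝ :=
  ∑ i, 1 / (2 * c i) * ‖x₀ i - xs‖ ^ 2

end DPGAW

end

noncomputable section

open scoped BigOperators

namespace DPGAW

/-! ### Convex functions and the proximal map -/

section SingleFunction

variable {n : ℕ} {ξ : Vec n → EReal}

/-! Since `W ⊗ Iₙ` vanishes exactly on consensus vectors, the problem is to minimize `F` subject to
`(W ⊗ Iₙ) 𝐱 = 0`, and DPGA-W is a primal-dual proximal gradient method for it. From the first
iteration on, `s` is `W x` scaled by `1 / τ`, and `p k + s k` is a prediction of `p (k + 1)`.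

One proximal gradient step (`prox_grad_descent`), paired with a consensus vector `z` and any dual
point `q`, bounds the Lagrangian gap by the decrease of a weighted squared distance to `(z, q)`, up
to the prediction error `‖s (k + 1) - s k‖²`. That error comes from `W` applied to the increment of
`x`. Weighted Cauchy–Schwarz (`sum_norm_blockMap_sq_le`) and the step-size rule let the primal
increment absorb it (`fejer`).

Telescoping and Jensen bound the gap at the average by `1 / t` times the initial distance, for every
`q`. Taking `q = 0` gives the upper bound. Shifting a multiplier in the direction of `W x̄` bounds
the violation, and this in turn bounds the suboptimality from below. A multiplier comes from the
saddle point or, under the relative interior condition, from proper separation. Only `Wᵀ q` matters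
and its blocks are negatives of subgradients at `xs`, so `q` may be replaced by a preimage of norm
controlled by `κ` and the least nonzero singular value.

With strict step sizes the increments and `s` tend to zero. A cluster point is then a primal-dual
solution, and monotonicity of the distance to that very point turns subsequential convergence into
convergence. -/

theorem IsClosedConvex.coe_toReal (h : IsClosedConvex ξ) {x : Vec n} (hx : x ∈ dom ξ) :
    ((ξ x).toReal : EReal) = ξ x :=
  EReal.coe_toReal (ne_of_lt hx) (h.ne_bot x)

theorem IsClosedConvex.mem_dom_of_le (h : IsClosedConvex ξ) {x : Vec n} {r : ℝ}
    (hx : ξ x ≤ (r : EReal)) : x ∈ dom ξ ∧ (ξ x).toReal ≤ r := by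
  have hd : x ∈ dom ξ := lt_of_le_of_lt hx (EReal.coe_lt_top r)
  refine ⟨hd, ?_⟩
  rw [← h.coe_toReal hd] at hx
  exact_mod_cast hx

theorem IsClosedConvex.convexOn (h : IsClosedConvex ξ) :
    ConvexOn ℝ (dom ξ) (fun x => (ξ x).toReal) := by
  have key : ∀ x ∈ dom ξ, ∀ y ∈ dom ξ, ∀ a b : ℝ, 0 ≤ a → 0 ≤ b → a + b = 1 →
      ξ (a • x + b • y) ≤ ((a * (ξ x).toReal + b * (ξ y).toReal : ℝ) : EReal) := by
    intro x hx y hy a b ha hb hab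
    have hx' : (x, (ξ x).toReal) ∈ {q : Vec n × ℝ | ξ q.1 ≤ (q.2 : EReal)} :=
      (h.coe_toReal hx).ge
    have hy' : (y, (ξ y).toReal) ∈ {q : Vec n × ℝ | ξ q.1 ≤ (q.2 : EReal)} :=
      (h.coe_toReal hy).ge
    simpa using h.convex_epi hx' hy' ha hb hab
  refine ⟨fun x hx y hy a b ha hb hab => (h.mem_dom_of_le (key x hx y hy a b ha hb hab)).1,
    fun x hx y hy a b ha hb hab => ?_⟩
  simpa using (h.mem_dom_of_le (key x hx y hy a b ha hb hab)).2

theorem IsClosedConvex.mem_dom_of_tendsto (h : IsClosedConvex ξ) {x : Vec n} {r : ℝ}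
    {xk : ℕ → Vec n} {rk : ℕ → ℝ} (hx : Filter.Tendsto xk Filter.atTop (nhds x))
    (hr : Filter.Tendsto rk Filter.atTop (nhds r)) (hle : ∀ k, ξ (xk k) ≤ (rk k : EReal)) :
    x ∈ dom ξ ∧ (ξ x).toReal ≤ r := by
  apply h.mem_dom_of_le
  have hcl := h.lsc.isClosed_epigraph
  have hr' : Filter.Tendsto (fun k => ((rk k : ℝ) : EReal)) Filter.atTop (nhds (r : EReal)) :=
    (continuous_coe_real_ereal.tendsto r).comp hr
  exact hcl.mem_of_tendsto (hx.prodMk_nhds hr') (Filter.Eventually.of_forall hle)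

theorem IsProx.mem_dom {c : ℝ} (hc : 0 < c) {z y : Vec n} (hp : IsProx c ξ z y)
    (h : IsClosedConvex ξ) (hne : (dom ξ).Nonempty) : y ∈ dom ξ := by
  obtain ⟨d, hd⟩ := hne
  by_contra hy
  have hy' : ξ y = ⊤ := by simpa [dom] using hy
  have := hp d
  rw [hy', EReal.coe_mul_top_of_pos hc, EReal.top_add_coe, ← h.coe_toReal hd, ← EReal.coe_mul,
    ← EReal.coe_add, top_le_iff] at this
  exact EReal.coe_ne_top _ this

/-- The variational inequality that characterizes the proximal point. -/
theorem IsProx.le_add_inner {c : ℝ} (hc : 0 < c) {z y : Vec n} (hp : IsProx c ξ z y)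
    (h : IsClosedConvex ξ) {u : Vec n} (hu : u ∈ dom ξ) :
    c * (ξ y).toReal ≤ c * (ξ u).toReal + inner ℝ (y - z) (u - y) := by
  have hy : y ∈ dom ξ := hp.mem_dom hc h ⟨u, hu⟩
  -- Compare `y` with the point at parameter `t` on the segment to `u`. After division by `t` only
  -- an error of order `t` remains.
  have key : ∀ t : ℝ, 0 < t → t ≤ 1 →
      c * (ξ y).toReal - c * (ξ u).toReal - inner ℝ (y - z) (u - y) ≤ t * (‖u - y‖ ^ 2 / 2) := by
    intro t ht ht1
    have hcv := h.convexOn.2 hy hu (by linarith : 0 ≤ 1 - t) ht.le (by ring)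
    have hdm := h.convexOn.1 hy hu (by linarith : 0 ≤ 1 - t) ht.le (by ring)
    have h1 := hp ((1 - t) • y + t • u)
    rw [← h.coe_toReal hy, ← h.coe_toReal hdm, ← EReal.coe_mul, ← EReal.coe_mul,
      ← EReal.coe_add, ← EReal.coe_add, EReal.coe_le_coe_iff] at h1
    have e : (1 - t) • y + t • u - z = (y - z) + t • (u - y) := by module
    rw [e, norm_add_sq_real, inner_smul_right, norm_smul, mul_pow, Real.norm_eq_abs, sq_abs] at h1
    simp only [smul_eq_mul] at hcv
    have h2 := mul_le_mul_of_nonneg_left hcv hc.le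
    have h3 : t * (c * (ξ y).toReal - c * (ξ u).toReal - inner ℝ (y - z) (u - y)) ≤
        t * (t * (‖u - y‖ ^ 2 / 2)) := by nlinarith
    exact le_of_mul_le_mul_left h3 ht
  by_contra hcon
  push Not at hcon
  set A := c * (ξ y).toReal - c * (ξ u).toReal - inner ℝ (y - z) (u - y) with hA
  have hApos : 0 < A := by linarith
  have hB : 0 ≤ ‖u - y‖ ^ 2 / 2 := by positivity
  set B := ‖u - y‖ ^ 2 / 2
  -- This `t` makes the error at most `A / 2`; the `+ 1` avoids dividing by zero when `u = y`.
  have h1 := key (min 1 (A / (2 * (B + 1)))) (by positivity) (min_le_left _ _)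
  have h2 : min 1 (A / (2 * (B + 1))) * B ≤ A / (2 * (B + 1)) * B :=
    mul_le_mul_of_nonneg_right (min_le_right _ _) hB
  have h3 : A / (2 * (B + 1)) * B ≤ A / 2 := by
    rw [div_mul_eq_mul_div, div_le_div_iff₀ (by positivity) (by positivity)]
    nlinarith
  linarith

end SingleFunction

/-! ### First-order inequalities for smooth and for convex functions -/

section Smooth

variable {E : Type*} [NormedAddCommGroup E] [InnerProductSpace ℝ E] [CompleteSpace E]

theorem hasDerivAt_comp_segment {f : E → ℝ} {x d : E} {t : ℝ}
    (h : DifferentiableAt ℝ f (x + t • d)) :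
    HasDerivAt (fun r : ℝ => f (x + r • d)) (inner ℝ (gradient f (x + t • d)) d) t := by
  rw [inner_gradient_left]
  have h1 : HasDerivAt (fun r : ℝ => x + r • d) d t := by
    simpa using ((hasDerivAt_id t).smul_const d).const_add x
  exact h.hasFDerivAt.comp_hasDerivAt t h1

/-- The descent lemma along a segment. -/
theorem le_add_inner_gradient_add_sq {f : E → ℝ} {U : Set E} {L : NNReal}
    (hdiff : ∀ z ∈ U, DifferentiableAt ℝ f z) (hL : LipschitzOnWith L (gradient f) U)
    {x y : E} (hseg : segment ℝ x y ⊆ U) :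
    f y ≤ f x + inner ℝ (gradient f x) (y - x) + L / 2 * ‖y - x‖ ^ 2 := by
  set d := y - x with hd
  have hmem : ∀ t ∈ Set.Icc (0 : ℝ) 1, x + t • d ∈ U := fun t ht =>
    hseg (segment_eq_image' ℝ x y ▸ ⟨t, ht, rfl⟩)
  -- The claim is `φ 1 ≤ φ 0`. The derivative is nonpositive by Cauchy–Schwarz and the Lipschitz
  -- bound, needed only on the segment.
  let φ : ℝ → ℝ := fun t => f (x + t • d) - t * inner ℝ (gradient f x) d - t ^ 2 * (L / 2 * ‖d‖ ^ 2)
  have hφ : ∀ t ∈ Set.Icc (0 : ℝ) 1, HasDerivAt φ (inner ℝ (gradient f (x + t • d)) d -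
      inner ℝ (gradient f x) d - t * (L * ‖d‖ ^ 2)) t := by
    intro t ht
    have h1 := hasDerivAt_comp_segment (hdiff _ (hmem t ht))
    have h2 := (hasDerivAt_id t).mul_const (inner ℝ (gradient f x) d)
    have h3 := (hasDerivAt_pow 2 t).mul_const (L / 2 * ‖d‖ ^ 2)
    refine ((h1.sub h2).sub h3).congr_deriv ?_
    simp only [Nat.cast_ofNat]
    ring
  have hanti : AntitoneOn φ (Set.Icc 0 1) := by
    refine antitoneOn_of_deriv_nonpos (convex_Icc 0 1)
      (fun t ht => (hφ t ht).continuousAt.continuousWithinAt) (fun t ht => ?_) (fun t ht => ?_)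
    · exact (hφ t (interior_subset ht)).differentiableAt.differentiableWithinAt
    · have ht' := interior_subset ht
      rw [(hφ t ht').deriv, ← inner_sub_left]
      have h1 := real_inner_le_norm (gradient f (x + t • d) - gradient f x) d
      have h2 := hL.dist_le_mul _ (hmem t ht') _ (by simpa using hmem 0 (by simp))
      rw [dist_eq_norm, dist_eq_norm, add_sub_cancel_left, norm_smul, Real.norm_eq_abs,
        abs_of_nonneg ht'.1] at h2
      have h3 := mul_le_mul_of_nonneg_right h2 (norm_nonneg d)
      nlinarith
  have := hanti (by simp : (0 : ℝ) ∈ Set.Icc 0 1) (by simp : (1 : ℝ) ∈ Set.Icc 0 1) zero_le_one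
  simp only [φ, one_smul, zero_smul, add_zero, hd, add_sub_cancel] at this
  rw [hd]
  linarith

theorem add_inner_gradient_le_of_convexOn {f : E → ℝ} (hf : ConvexOn ℝ Set.univ f) {x : E}
    (hx : DifferentiableAt ℝ f x) (y : E) :
    f x + inner ℝ (gradient f x) (y - x) ≤ f y := by
  have hx' : DifferentiableAt ℝ f (x + (0 : ℝ) • (y - x)) := by simpa using hx
  have h1 := hasDerivAt_comp_segment hx'
  have hcv : ConvexOn ℝ Set.univ (fun r : ℝ => f (x + r • (y - x))) := by
    refine ⟨convex_univ, fun r _ t _ a b ha hb hab => ?_⟩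
    have h2 := hf.2 (Set.mem_univ (x + r • (y - x))) (Set.mem_univ (x + t • (y - x))) ha hb hab
    have e : x + (a • r + b • t) • (y - x) = a • (x + r • (y - x)) + b • (x + t • (y - x)) := by
      have : b = 1 - a := by linarith
      subst this
      simp only [smul_eq_mul]
      module
    simpa only [e] using h2
  have h2 := hcv.le_slope_of_hasDerivAt (Set.mem_univ 0) (Set.mem_univ 1) zero_lt_one h1
  simp only [slope_def_field, one_smul, zero_smul, add_zero, add_sub_cancel, sub_zero,
    div_one] at h2
  linarith

end Smooth

/-! ### Relative interiors and proper separation -/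

section Separation

variable {V : Type*} [NormedAddCommGroup V] [NormedSpace ℝ V]

/-- Prolonging a segment slightly past a relative interior point stays in the affine span, hence in
a relative neighbourhood of that point. -/
theorem eventually_add_smul_mem_of_mem_intrinsicInterior {s : Set V} {x y : V}
    (hx : x ∈ intrinsicInterior ℝ s) (hy : y ∈ s) :
    ∀ᶠ ε : ℝ in nhds 0, x + ε • (x - y) ∈ s := by
  obtain ⟨x', hx', rfl⟩ := mem_intrinsicInterior.1 hx
  have hmem : ∀ ε : ℝ, (x' : V) + ε • ((x' : V) - y) ∈ affineSpan ℝ s := by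
    intro ε
    have := AffineMap.lineMap_mem (-ε) x'.2 (mem_affineSpan ℝ hy)
    convert this using 1
    simp [AffineMap.lineMap_apply, smul_sub]
    abel
  have hcont : Continuous fun ε : ℝ => (⟨_, hmem ε⟩ : affineSpan ℝ s) :=
    Continuous.subtype_mk (by fun_prop) _
  have h0 : (⟨_, hmem 0⟩ : affineSpan ℝ s) = x' := by ext; simp
  have hnh : interior ((↑) ⁻¹' s : Set (affineSpan ℝ s)) ∈ nhds (⟨_, hmem 0⟩ : affineSpan ℝ s) := by
    rw [h0]
    exact isOpen_interior.mem_nhds hx'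
  filter_upwards [hcont.continuousAt.eventually_mem hnh] with ε hε
  exact (interior_subset hε :
    (⟨_, hmem ε⟩ : affineSpan ℝ s) ∈ ((↑) ⁻¹' s : Set (affineSpan ℝ s)))

/-- Proper separation of the origin from a convex set in finite dimension. -/
theorem exists_linear_nonneg_of_zero_notMem [FiniteDimensional ℝ V] {C : Set V}
    (hC : Convex ℝ C) (hne : C.Nonempty) (h0 : (0 : V) ∉ C) :
    ∃ l : V →ₗ[ℝ] ℝ, (∀ x ∈ C, 0 ≤ l x) ∧ ∃ x ∈ C, 0 < l x := by
  set S := Submodule.span ℝ C with hS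
  -- The positive multiples of `C` inside its span have full affine span, as they contain both `z`
  -- and `2 z`. So `K` has interior, and strict separation there makes the separation proper.
  let K : Set S := {z | ∃ t : ℝ, 0 < t ∧ ∃ x ∈ C, (z : V) = t • x}
  have hCK : ∀ x (hx : x ∈ C), (⟨x, Submodule.subset_span hx⟩ : S) ∈ K := fun x hx =>
    ⟨1, one_pos, x, hx, by simp⟩
  have hK : Convex ℝ K := by
    rw [convex_iff_forall_pos]
    rintro z ⟨t, ht, x, hx, hz⟩ w ⟨r, hr, y, hy, hw⟩ a b ha hb _
    have hpos : 0 < a * t + b * r := by positivity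
    refine ⟨a * t + b * r, hpos, (a * t / (a * t + b * r)) • x + (b * r / (a * t + b * r)) • y,
      hC hx hy (by positivity) (by positivity) (by field_simp), ?_⟩
    simp only [Submodule.coe_add, Submodule.coe_smul, hz, hw, smul_add, smul_smul]
    rw [mul_div_cancel₀ _ hpos.ne', mul_div_cancel₀ _ hpos.ne']
  have hKne : K.Nonempty := hne.elim fun x hx => ⟨_, hCK x hx⟩
  have hspan : affineSpan ℝ K = ⊤ := by
    rw [AffineSubspace.affineSpan_eq_top_iff_vectorSpan_eq_top_of_nonempty ℝ _ _ hKne, eq_top_iff,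
      ← Submodule.span_span_coe_preimage (s := C), Submodule.span_le]
    intro z hz
    have hz1 : z ∈ K := hCK z hz
    have hz2 : (2 : ℝ) • z ∈ K := ⟨2, two_pos, z, hz, rfl⟩
    have := vsub_mem_vectorSpan ℝ hz2 hz1
    rwa [vsub_eq_sub, two_smul, add_sub_cancel_right] at this
  have hint : (interior K).Nonempty := hK.interior_nonempty_iff_affineSpan_eq_top.2 hspan
  have h0K : (0 : S) ∉ interior K := by
    intro h
    obtain ⟨t, ht, x, hx, hz⟩ := interior_subset h
    have : x = 0 := by
      have := hz.symm
      simpa [ht.ne'] using this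
    exact h0 (this ▸ hx)
  obtain ⟨g, hg⟩ := geometric_hahn_banach_open_point hK.interior isOpen_interior h0K
  rw [map_zero] at hg
  have hgK : ∀ z ∈ K, g z ≤ 0 := by
    intro z hz
    have hz' : z ∈ closure (interior K) := by
      rw [hK.closure_interior_eq_closure_of_nonempty_interior hint]
      exact subset_closure hz
    exact closure_minimal (fun w hw => (hg w hw).le) (isClosed_le g.continuous continuous_const) hz'
  obtain ⟨l, hl⟩ := LinearMap.exists_extend (-(g : S →ₗ[ℝ] ℝ))
  have hlS : ∀ z : S, l z = -g z := fun z => by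
    simpa using LinearMap.congr_fun hl z
  refine ⟨l, fun x hx => ?_, ?_⟩
  · have := hlS ⟨x, Submodule.subset_span hx⟩
    rw [this]
    linarith [hgK _ (hCK x hx)]
  · obtain ⟨z, hz⟩ := hint
    obtain ⟨t, ht, x, hx, hzx⟩ := interior_subset hz
    refine ⟨x, hx, ?_⟩
    have h1 : 0 < l z := by rw [hlS]; linarith [hg z hz]
    rw [hzx, map_smul, smul_eq_mul] at h1
    exact (pos_iff_pos_of_mul_pos h1).1 ht

end Separation

/-! ### Block matrices -/

section Block

variable {n N : ℕ}

/-- The action of `A ⊗ Iₙ` on families of vectors. -/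
def blockMap (A : Matrix (Fin N) (Fin N) ℝ) : (Fin N → Vec n) →ₗ[ℝ] (Fin N → Vec n) where
  toFun x i := ∑ j, A i j • x j
  map_add' x y := by ext1 i; simp [Finset.sum_add_distrib]
  map_smul' r x := by ext1 i; simp [Finset.smul_sum, smul_comm r]

theorem blockMap_apply (A : Matrix (Fin N) (Fin N) ℝ) (x : Fin N → Vec n) (i : Fin N) :
    blockMap A x i = ∑ j, A i j • x j := rfl

theorem sum_inner_blockMap (A : Matrix (Fin N) (Fin N) ℝ) (a b : Fin N → Vec n) :
    ∑ i, inner ℝ (a i) (blockMap A b i) = ∑ i, inner ℝ (blockMap A.transpose a i) (b i) := by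
  simp only [blockMap_apply, inner_sum, sum_inner, inner_smul_left, inner_smul_right]
  rw [Finset.sum_comm]
  simp

theorem norm_kronApply_sq (A : Matrix (Fin N) (Fin N) ℝ) (x : Fin N → Vec n) :
    ‖kronApply A x‖ ^ 2 = ∑ i, ‖blockMap A x i‖ ^ 2 := by
  rw [PiLp.norm_sq_eq_of_L2]
  rfl

end Block

/-! ### Communication matrices of connected graphs -/

section Graph

theorem forall_of_adj {N : ℕ} {G : SimpleGraph (Fin N)} (hG : G.Connected) {P : Fin N → Prop} {i₀ : Fin N} (h₀ : P i₀)
    (hadj : ∀ i j, G.Adj i j → P i → P j) (j : Fin N) : P j := by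
  have := (SimpleGraph.reachable_iff_reflTransGen i₀ j).1 (hG.preconnected i₀ j)
  induction this with
  | refl => exact h₀
  | tail _ h ih => exact hadj _ _ h ih

variable {n N : ℕ} {G : SimpleGraph (Fin N)} [DecidableRel G.Adj] {W : Matrix (Fin N) (Fin N) ℝ}

theorem mem_closedNbhd_comm {i j : Fin N} : j ∈ closedNbhd G i ↔ i ∈ closedNbhd G j := by
  simp [closedNbhd, G.adj_comm i j, eq_comm (a := i)]

theorem IsCommunicationMatrix.sum_closedNbhd (hW : IsCommunicationMatrix G W)
    (x : Fin N → Vec n) (i : Fin N) : ∑ j ∈ closedNbhd G i, W i j • x j = blockMap W x i := by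
  refine Finset.sum_subset (Finset.subset_univ _) fun j _ hj => ?_
  rw [hW.eq_zero i j hj, zero_smul]

theorem IsCommunicationMatrix.sum_closedNbhd_transpose (hW : IsCommunicationMatrix G W)
    (x : Fin N → Vec n) (i : Fin N) :
    ∑ j ∈ closedNbhd G i, W j i • x j = blockMap W.transpose x i := by
  refine Finset.sum_subset (Finset.subset_univ _) fun j _ hj => ?_
  rw [hW.eq_zero j i (fun h => hj (mem_closedNbhd_comm.1 h)), zero_smul]

theorem tau_pos {γ : Fin N → ℝ} (hγ : ∀ i, 0 < γ i) (i : Fin N) : 0 < tau G γ i :=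
  Finset.sum_pos (fun j _ => one_div_pos.2 (hγ j)) ⟨i, Finset.mem_insert_self _ _⟩

theorem tau_le_tauMax (γ : Fin N → ℝ) (i : Fin N) : tau G γ i ≤ tauMax G γ :=
  le_ciSup (Set.finite_range _).bddAbove i

/-- `Wᵀ diag(τ)⁻¹ W ≼ diag(γᵢ ‖ωᵢ‖²)`. -/
theorem IsCommunicationMatrix.sum_norm_blockMap_sq_le (hW : IsCommunicationMatrix G W)
    {γ : Fin N → ℝ} (hγ : ∀ i, 0 < γ i) (d : Fin N → Vec n) :
    ∑ j, (tau G γ j)⁻¹ * ‖blockMap W d j‖ ^ 2 ≤ ∑ i, γ i * colNormSq W i * ‖d i‖ ^ 2 := by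
  have hrow : ∀ j, (tau G γ j)⁻¹ * ‖blockMap W d j‖ ^ 2 ≤
      ∑ i, γ i * (W j i ^ 2 * ‖d i‖ ^ 2) := by
    intro j
    have h1 : ‖blockMap W d j‖ ≤ ∑ i ∈ closedNbhd G j, |W j i| * ‖d i‖ := by
      rw [← hW.sum_closedNbhd]
      refine (norm_sum_le _ _).trans_eq (Finset.sum_congr rfl fun i _ => ?_)
      rw [norm_smul, Real.norm_eq_abs]
    -- Cauchy–Schwarz with weights `1 / γ i` and `γ i`; the first weights add up to `tau G γ j`.
    have h2 : (∑ i ∈ closedNbhd G j, |W j i| * ‖d i‖) ^ 2 ≤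
        tau G γ j * ∑ i ∈ closedNbhd G j, γ i * (W j i ^ 2 * ‖d i‖ ^ 2) := by
      refine Finset.sum_sq_le_sum_mul_sum_of_sq_le_mul _ (fun i _ => (one_div_pos.2 (hγ i)).le)
        (fun i _ => mul_nonneg (hγ i).le (by positivity)) (fun i _ => ?_)
      have := (hγ i).ne'
      rw [mul_pow, sq_abs]
      field_simp
      exact le_rfl
    have h3 : ∑ i ∈ closedNbhd G j, γ i * (W j i ^ 2 * ‖d i‖ ^ 2) ≤
        ∑ i, γ i * (W j i ^ 2 * ‖d i‖ ^ 2) :=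
      Finset.sum_le_sum_of_subset_of_nonneg (Finset.subset_univ _)
        fun i _ _ => mul_nonneg (hγ i).le (by positivity)
    have ht := tau_pos (G := G) hγ j
    rw [inv_mul_le_iff₀ ht]
    calc ‖blockMap W d j‖ ^ 2 ≤ (∑ i ∈ closedNbhd G j, |W j i| * ‖d i‖) ^ 2 := by gcongr
      _ ≤ _ := h2
      _ ≤ _ := mul_le_mul_of_nonneg_left h3 ht.le
  refine (Finset.sum_le_sum fun j _ => hrow j).trans_eq ?_
  rw [Finset.sum_comm]
  refine Finset.sum_congr rfl fun i _ => ?_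
  rw [colNormSq, Finset.mul_sum, Finset.sum_mul]
  exact Finset.sum_congr rfl fun j _ => by ring

theorem IsCommunicationMatrix.blockMap_eq_sum_sub (hW : IsCommunicationMatrix G W)
    (x : Fin N → Vec n) (i : Fin N) :
    blockMap W x i = ∑ j ∈ G.neighborFinset i, (-W i j) • (x i - x j) := by
  rw [← hW.sum_closedNbhd, closedNbhd, Finset.sum_insert (by simp), hW.diag, neg_smul,
    Finset.sum_smul, ← Finset.sum_neg_distrib, ← Finset.sum_add_distrib]
  exact Finset.sum_congr rfl fun j _ => by module

theorem IsCommunicationMatrix.blockMap_const (hW : IsCommunicationMatrix G W) (v : Vec n) :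
    blockMap W (fun _ => v) = 0 := by
  ext1 i
  simp [hW.blockMap_eq_sum_sub]

/-- The kernel of `W ⊗ Iₙ` consists of the consensus vectors. -/
theorem IsCommunicationMatrix.eq_of_blockMap_eq_zero (hW : IsCommunicationMatrix G W)
    (hG : G.Connected) {x : Fin N → Vec n} (hx : blockMap W x = 0) (i j : Fin N) : x i = x j := by
  ext a
  have : Nonempty (Fin N) := ⟨i⟩
  -- Maximum principle in each coordinate: at a maximizing vertex all terms of the row are
  -- nonnegative and sum to zero, so every neighbour is maximizing too. Symmetry of `W` plays no
  -- role.
  obtain ⟨i₀, hi₀⟩ := Finite.exists_max (fun i => x i a)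
  have hall : ∀ k, x k a = x i₀ a := by
    refine forall_of_adj hG rfl fun k l hkl hk => ?_
    have h1 : ∑ m ∈ G.neighborFinset k, (-W k m) * (x k a - x m a) = 0 := by
      have := congrArg (fun z : Vec n => z a) ((hW.blockMap_eq_sum_sub x k).symm.trans
        (congrFun hx k))
      simpa using this
    have h2 : ∀ m ∈ G.neighborFinset k, 0 ≤ (-W k m) * (x k a - x m a) := fun m hm =>
      mul_nonneg (neg_nonneg.2 (hW.neg k m hm).le) (by rw [hk]; linarith [hi₀ m])
    have hl : l ∈ G.neighborFinset k := by simpa using hkl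
    have h3 := (Finset.sum_eq_zero_iff_of_nonneg h2).1 h1 l hl
    rcases mul_eq_zero.1 h3 with h | h
    · linarith [hW.neg k l hl]
    · linarith
  rw [hall i, hall j]

/-- The kernel of `W ⊗ Iₙ` consists of consensus vectors, which the Laplacian kills. The factor `M`
is the Laplacian after a section of `W ⊗ Iₙ` over its range, extended to the whole space. -/
theorem IsCommunicationMatrix.exists_blockMap_lapMatrix_eq (hW : IsCommunicationMatrix G W)
    (hG : G.Connected) : ∃ M : (Fin N → Vec n) →ₗ[ℝ] (Fin N → Vec n),
      ∀ x, blockMap (G.lapMatrix ℝ) x = M (blockMap W x) := by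
  obtain ⟨g, hg⟩ := (blockMap (n := n) W).rangeRestrict.exists_rightInverse_of_surjective
    (LinearMap.range_rangeRestrict _)
  obtain ⟨g', hg'⟩ := LinearMap.exists_extend g
  refine ⟨blockMap (G.lapMatrix ℝ) ∘ₗ g', fun x => ?_⟩
  have h1 : g' (blockMap W x) = g ((blockMap W).rangeRestrict x) := by
    rw [← hg']; rfl
  have h2 : blockMap W (x - g' (blockMap W x)) = 0 := by
    rw [map_sub, h1, sub_eq_zero]
    have := LinearMap.congr_fun hg ((blockMap W).rangeRestrict x)
    exact (congrArg Subtype.val this).symm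
  have h3 : blockMap (G.lapMatrix ℝ) (x - g' (blockMap W x)) = 0 := by
    ext1 i
    have hc := hW.eq_of_blockMap_eq_zero hG h2
    rw [blockMap_apply, Finset.sum_congr rfl fun j _ => by rw [hc j i], ← Finset.sum_smul]
    have := congrFun (G.lapMatrix_mulVec_const_eq_zero (R := ℝ)) i
    simp only [Matrix.mulVec, dotProduct, mul_one] at this
    rw [this, Pi.zero_apply, Pi.zero_apply, zero_smul]
  rwa [map_sub, sub_eq_zero] at h3

theorem IsCommunicationMatrix.exists_norm_lapMatrix_le (hW : IsCommunicationMatrix G W)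
    (hG : G.Connected) : ∃ C : ℝ, ∀ x : Fin N → Vec n,
      ‖kronApply (G.lapMatrix ℝ) x‖ ≤ C * ‖kronApply W x‖ := by
  obtain ⟨M, hM⟩ := hW.exists_blockMap_lapMatrix_eq (n := n) hG
  have hbound : ∃ K : ℝ, 0 ≤ K ∧ ∀ y, ‖M y‖ ≤ K * ‖y‖ :=
    ⟨_, norm_nonneg _, (LinearMap.toContinuousLinearMap M).le_opNorm⟩
  obtain ⟨K, hK0, hK⟩ := hbound
  -- `K` is an operator norm for the sup norm on blocks; `√N` is the cost of passing to the
  -- Euclidean norm.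
  refine ⟨√N * K, fun x => le_of_sq_le_sq ?_ (by positivity)⟩
  have h1 : ‖blockMap W x‖ ≤ ‖kronApply W x‖ := by
    refine (pi_norm_le_iff_of_nonneg (norm_nonneg _)).2 fun i => ?_
    refine le_of_sq_le_sq ?_ (norm_nonneg _)
    rw [norm_kronApply_sq]
    exact Finset.single_le_sum (f := fun i => ‖blockMap W x i‖ ^ 2) (fun j _ => sq_nonneg _)
      (Finset.mem_univ i)
  have h2 : ∀ i, ‖blockMap (G.lapMatrix ℝ) x i‖ ≤ K * ‖kronApply W x‖ := by
    intro i
    rw [hM]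
    exact ((norm_le_pi_norm _ i).trans (hK _)).trans (mul_le_mul_of_nonneg_left h1 hK0)
  rw [norm_kronApply_sq, mul_assoc, mul_pow, Real.sq_sqrt (Nat.cast_nonneg _)]
  calc ∑ i, ‖blockMap (G.lapMatrix ℝ) x i‖ ^ 2 ≤ ∑ _i : Fin N, (K * ‖kronApply W x‖) ^ 2 :=
        Finset.sum_le_sum fun i _ => pow_le_pow_left₀ (norm_nonneg _) (h2 i) 2
    _ = N * (K * ‖kronApply W x‖) ^ 2 := by simp

end Graph

/-! ### The smallest nonzero singular value -/

section SingularValues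

variable {E F : Type*} [NormedAddCommGroup E] [InnerProductSpace ℝ E] [FiniteDimensional ℝ E]
  [NormedAddCommGroup F] [InnerProductSpace ℝ F] [FiniteDimensional ℝ F]

/-- The smallest nonzero singular value of a linear map. -/
def minSingularValue (T : E →ₗ[ℝ] F) : ℝ :=
  sInf {σ : ℝ | 0 < σ ∧ ∃ k : ℕ, T.singularValues k = σ}

theorem minSingularValue_le {T : E →ₗ[ℝ] F} {k : ℕ} (hk : T.singularValues k ≠ 0) :
    minSingularValue T ≤ T.singularValues k :=
  csInf_le ⟨0, fun _ h => h.1.le⟩ ⟨(T.singularValues_pos_iff_ne_zero k).2 hk, k, rfl⟩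

theorem minSingularValue_pos {T : E →ₗ[ℝ] F} (hT : T ≠ 0) : 0 < minSingularValue T := by
  set S := {σ : ℝ | 0 < σ ∧ ∃ k : ℕ, T.singularValues k = σ} with hS
  have hne : S.Nonempty := by
    by_contra h
    refine hT (T.singularValues_eq_zero_iff.1 (Finsupp.ext fun k => ?_))
    by_contra hk
    exact h ⟨_, (T.singularValues_pos_iff_ne_zero k).2 hk, k, rfl⟩
  have hfin : S.Finite := by
    refine (T.singularValues.support.finite_toSet.image T.singularValues).subset ?_
    rintro _ ⟨h0, k, rfl⟩
    exact ⟨k, Finsupp.mem_support_iff.2 h0.ne', rfl⟩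
  exact (hne.csInf_mem hfin).1

/-- In an eigenbasis of `T* T`, the directions with zero singular value lie in the kernel and are
orthogonal to `y`; the others are stretched by at least the minimum. -/
theorem minSingularValue_mul_norm_le (T : E →ₗ[ℝ] F) {y : E} (hy : y ∈ T.kerᗮ) :
    minSingularValue T * ‖y‖ ≤ ‖T y‖ := by
  by_cases hT : T = 0
  · subst hT
    have : y = 0 := by simpa using hy
    simp [this]
  have hpos := minSingularValue_pos hT
  have hs := T.isSymmetric_adjoint_comp_self
  let b := hs.eigenvectorBasis rfl
  have h1 : ‖T y‖ ^ 2 = ∑ i : Fin _, T.singularValues i ^ 2 * inner ℝ (b i) y ^ 2 := by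
    rw [← real_inner_self_eq_norm_sq, ← LinearMap.adjoint_inner_right,
      ← b.sum_inner_mul_inner]
    refine Finset.sum_congr rfl fun i _ => ?_
    have e1 : inner ℝ (b i) (T.adjoint (T y)) = T.singularValues i ^ 2 * inner ℝ (b i) y := by
      have := hs (b i) y
      simp only [LinearMap.comp_apply] at this
      rw [← this]
      have e2 := hs.apply_eigenvectorBasis rfl i
      simp only [LinearMap.comp_apply] at e2
      change inner ℝ (T.adjoint (T (hs.eigenvectorBasis rfl i))) y = _
      rw [e2, T.sq_singularValues_fin rfl, inner_smul_left]
      simp [b]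
    rw [e1, real_inner_comm]
    ring
  have h2 : ‖y‖ ^ 2 = ∑ i, inner ℝ (b i) y ^ 2 := by
    rw [← b.sum_sq_norm_inner_right]
    simp
  refine le_of_sq_le_sq ?_ (norm_nonneg _)
  rw [mul_pow, h1, h2, Finset.mul_sum]
  refine Finset.sum_le_sum fun i _ => ?_
  by_cases hi : T.singularValues i = 0
  · have hker : b i ∈ T.ker := by
      rw [LinearMap.mem_ker, ← norm_eq_zero, ← sq_eq_zero_iff, ← real_inner_self_eq_norm_sq,
        ← LinearMap.adjoint_inner_right]
      have e2 := hs.apply_eigenvectorBasis rfl i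
      rw [← T.sq_singularValues_fin rfl, hi] at e2
      simp only [LinearMap.comp_apply] at e2
      change inner ℝ _ (T.adjoint (T (hs.eigenvectorBasis rfl i))) = 0
      rw [e2]
      simp
    rw [Submodule.inner_right_of_mem_orthogonal hker hy]
    simp
  · have := minSingularValue_le hi
    gcongr

theorem exists_adjoint_eq_norm_sq_le (T : E →ₗ[ℝ] F) (v : F) :
    ∃ w, T.adjoint w = T.adjoint v ∧ ‖w‖ ^ 2 ≤ ‖T.adjoint v‖ ^ 2 / minSingularValue T ^ 2 := by
  by_cases hT : T = 0
  · subst hT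
    -- For `T = 0` the infimum is over the empty set; the bound holds because `w = 0`.
    refine ⟨0, by simp, ?_⟩
    simp only [norm_zero, ne_eq, OfNat.ofNat_ne_zero, not_false_eq_true, zero_pow]
    positivity
  have hpos := minSingularValue_pos hT
  obtain ⟨y₀, hy₀⟩ : T.range.starProjection v ∈ T.range :=
    Submodule.starProjection_apply_mem _ _
  -- The witness `T y` is the projection of `v` onto the range, so its adjoint image is unchanged;
  -- `y` is its preimage orthogonal to the kernel.
  set y := y₀ - T.ker.starProjection y₀ with hy
  have hyk : y ∈ T.kerᗮ := Submodule.sub_starProjection_mem_orthogonal _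
  have hTy : T y = T.range.starProjection v := by
    have : T (T.ker.starProjection y₀) = 0 := Submodule.starProjection_apply_mem T.ker y₀
    rw [hy, map_sub, this, sub_zero, hy₀]
  have hadj : T.adjoint (T y) = T.adjoint v := by
    rw [hTy, eq_comm, ← sub_eq_zero, ← map_sub]
    have h1 : v - T.range.starProjection v ∈ T.rangeᗮ :=
      Submodule.sub_starProjection_mem_orthogonal _
    refine ext_inner_left ℝ fun z => ?_
    rw [LinearMap.adjoint_inner_right, inner_zero_right]
    exact Submodule.inner_right_of_mem_orthogonal (LinearMap.mem_range_self T z) h1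
  refine ⟨T y, hadj, ?_⟩
  have h1 := minSingularValue_mul_norm_le T hyk
  have h2 : ‖T y‖ ^ 2 ≤ ‖y‖ * ‖T.adjoint v‖ := by
    rw [← real_inner_self_eq_norm_sq, ← LinearMap.adjoint_inner_right, hadj]
    exact real_inner_le_norm _ _
  have h3 : minSingularValue T * ‖T y‖ ≤ ‖T.adjoint v‖ := by
    rcases (norm_nonneg (T y)).eq_or_lt with h | h
    · rw [← h, mul_zero]; exact norm_nonneg _
    · refine le_of_mul_le_mul_left ?_ h
      nlinarith [norm_nonneg (T.adjoint v)]
  rw [le_div_iff₀ (by positivity), mul_comm, ← mul_pow]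
  gcongr

end SingularValues

theorem exists_blockMap_transpose_eq_norm_sq_le {n N : ℕ} (W : Matrix (Fin N) (Fin N) ℝ)
    (q : Fin N → Vec n) : ∃ p : Fin N → Vec n,
      blockMap W.transpose p = blockMap W.transpose q ∧
      ∑ i, ‖p i‖ ^ 2 ≤ (∑ i, ‖blockMap W.transpose q i‖ ^ 2) / sigmaMin W ^ 2 := by
  have hadj : (Matrix.toEuclideanLin W).adjoint = Matrix.toEuclideanLin W.transpose := by
    rw [← Matrix.toEuclideanLin_conjTranspose_eq_adjoint, Matrix.conjTranspose_eq_transpose_of_trivial]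
  have happ : ∀ (v : EuclideanSpace ℝ (Fin N)) (i : Fin N),
      (Matrix.toEuclideanLin W).adjoint v i = ∑ j, W.transpose i j * v j := by
    intro v i
    rw [hadj]
    simp [Matrix.toLpLin_apply, Matrix.mulVec, dotProduct]
  choose w hw hwn using fun a : Fin n => exists_adjoint_eq_norm_sq_le (Matrix.toEuclideanLin W)
    (WithLp.toLp 2 fun i => q i a)
  refine ⟨fun i => WithLp.toLp 2 fun a => w a i, ?_, ?_⟩
  · ext i a
    have := congrArg (fun z : EuclideanSpace ℝ (Fin N) => z i) (hw a)
    simp only [happ] at this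
    simpa [blockMap_apply] using this
  · simp only [EuclideanSpace.norm_sq_eq]
    rw [Finset.sum_comm, Finset.sum_comm (s := Finset.univ) (t := Finset.univ)
      (f := fun i a => ‖blockMap W.transpose q i a‖ ^ 2), Finset.sum_div]
    refine Finset.sum_le_sum fun a _ => ?_
    have := hwn a
    simp only [EuclideanSpace.norm_sq_eq, happ] at this
    simpa [blockMap_apply, sigmaMin, minSingularValue] using this

/-! ### Real-valued costs -/

section RealCost

variable {n N : ℕ} {ξ : Fin N → Vec n → EReal} {f : Fin N → Vec n → ℝ}

/-- The local cost as a real number, meaningful on the domain of `ξ i`. -/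
def realCost (ξ : Fin N → Vec n → EReal) (f : Fin N → Vec n → ℝ) (i : Fin N) (x : Vec n) : ℝ :=
  (ξ i x).toReal + f i x

theorem convexOn_realCost (hξ : ∀ i, IsClosedConvex (ξ i))
    (hf : ∀ i, ConvexOn ℝ Set.univ (f i)) (i : Fin N) :
    ConvexOn ℝ (dom (ξ i)) (realCost ξ f i) :=
  (hξ i).convexOn.add ((hf i).subset (Set.subset_univ _) (hξ i).convexOn.1)

theorem localCost_eq_coe (hξ : ∀ i, IsClosedConvex (ξ i)) {i : Fin N} {x : Vec n}
    (hx : x ∈ dom (ξ i)) : localCost (ξ i) (f i) x = (realCost ξ f i x : EReal) := by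
  rw [localCost, realCost, EReal.coe_add, (hξ i).coe_toReal hx]

theorem localCost_eq_top {i : Fin N} {x : Vec n} (hx : x ∉ dom (ξ i)) :
    localCost (ξ i) (f i) x = ⊤ := by
  have : ξ i x = ⊤ := by simpa [dom] using hx
  rw [localCost, this, EReal.top_add_coe]

theorem localCost_ne_bot (hξ : ∀ i, IsClosedConvex (ξ i)) (i : Fin N) (x : Vec n) :
    localCost (ξ i) (f i) x ≠ ⊥ := by
  by_cases hx : x ∈ dom (ξ i)
  · rw [localCost_eq_coe hξ hx]; exact EReal.coe_ne_bot _
  · rw [localCost_eq_top hx]; exact top_ne_bot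

theorem sum_ereal_ne_bot {ι : Type*} (s : Finset ι) {a : ι → EReal} (ha : ∀ i, a i ≠ ⊥) :
    ∑ i ∈ s, a i ≠ ⊥ := by
  classical
  induction s using Finset.induction_on with
  | empty => simp
  | insert i s hi ih =>
    rw [Finset.sum_insert hi, ne_eq, EReal.add_eq_bot_iff]
    exact not_or.2 ⟨ha i, ih⟩

theorem coe_sum_ereal {ι : Type*} (s : Finset ι) (a : ι → ℝ) :
    ((∑ i ∈ s, a i : ℝ) : EReal) = ∑ i ∈ s, (a i : EReal) := by
  classical
  induction s using Finset.induction_on with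
  | empty => simp
  | insert i s hi ih => rw [Finset.sum_insert hi, Finset.sum_insert hi, EReal.coe_add, ih]

theorem totalCost_eq_coe (hξ : ∀ i, IsClosedConvex (ξ i)) {x : Fin N → Vec n}
    (hx : ∀ i, x i ∈ dom (ξ i)) :
    totalCost ξ f x = ((∑ i, realCost ξ f i (x i) : ℝ) : EReal) := by
  rw [coe_sum_ereal]
  exact Finset.sum_congr rfl fun i _ => localCost_eq_coe hξ (hx i)

theorem mem_dom_of_totalCost_ne_top (hξ : ∀ i, IsClosedConvex (ξ i)) {x : Fin N → Vec n}
    (hx : totalCost ξ f x ≠ ⊤) (i : Fin N) : x i ∈ dom (ξ i) := by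
  by_contra hi
  refine hx ?_
  rw [totalCost, ← Finset.add_sum_erase _ _ (Finset.mem_univ i), localCost_eq_top hi]
  -- In `EReal`, `⊤ + ⊥ = ⊥`, so the other terms must be known not to be `⊥`.
  exact EReal.top_add_of_ne_bot (sum_ereal_ne_bot _ fun j => localCost_ne_bot hξ j (x j))

/-- A solution of the centralized problem is feasible, its value is finite, and it is minimal among
the feasible points. -/
theorem solution_mem_dom_and_le (hξ : ∀ i, IsClosedConvex (ξ i)) {xs : Vec n}
    (hxs : IsMinOn (centralCost ξ f) Set.univ xs) (hne : (⋂ i, dom (ξ i)).Nonempty) :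
    (∀ i, xs ∈ dom (ξ i)) ∧
      optValue ξ f = ((∑ i, realCost ξ f i xs : ℝ) : EReal) ∧
      ∀ z, (∀ i, z ∈ dom (ξ i)) → ∑ i, realCost ξ f i xs ≤ ∑ i, realCost ξ f i z := by
  obtain ⟨d, hd⟩ := hne
  rw [Set.mem_iInter] at hd
  have hle : ∀ z, centralCost ξ f xs ≤ centralCost ξ f z := fun z => hxs (Set.mem_univ z)
  have hmem : ∀ i, xs ∈ dom (ξ i) := by
    refine mem_dom_of_totalCost_ne_top (f := f) hξ (x := fun _ => xs) ?_
    refine ne_of_lt ((hle d).trans_lt ?_)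
    rw [centralCost, totalCost_eq_coe hξ hd]
    exact EReal.coe_lt_top _
  refine ⟨hmem, ?_, fun z hz => ?_⟩
  · rw [← totalCost_eq_coe hξ (x := fun _ => xs) hmem]
    exact le_antisymm (iInf_le _ xs) (le_iInf hle)
  · have := hle z
    rw [centralCost, centralCost, totalCost_eq_coe hξ hz, totalCost_eq_coe hξ hmem] at this
    exact_mod_cast this

end RealCost

/-! ### Multipliers -/

section Multiplier

variable {n N : ℕ} {G : SimpleGraph (Fin N)} [DecidableRel G.Adj] {W : Matrix (Fin N) (Fin N) ℝ}
  {ξ : Fin N → Vec n → EReal} {f : Fin N → Vec n → ℝ} {xs : Vec n}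

/-- `p` is a Lagrange multiplier of the constraint `(W ⊗ Iₙ) 𝐱 = 0` at the consensus
vector `xs`. -/
def IsMultiplier (W : Matrix (Fin N) (Fin N) ℝ) (ξ : Fin N → Vec n → EReal)
    (f : Fin N → Vec n → ℝ) (xs : Vec n) (p : Fin N → Vec n) : Prop :=
  ∀ x : Fin N → Vec n, (∀ i, x i ∈ dom (ξ i)) →
    ∑ i, realCost ξ f i xs ≤ ∑ i, realCost ξ f i (x i) + ∑ i, inner ℝ (p i) (blockMap W x i)

theorem IsMultiplier.congr {p q : Fin N → Vec n} (hp : IsMultiplier W ξ f xs p)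
    (h : blockMap W.transpose q = blockMap W.transpose p) : IsMultiplier W ξ f xs q := by
  intro x hx
  rw [sum_inner_blockMap, h, ← sum_inner_blockMap]
  exact hp x hx

theorem lagrangian_eq_coe (hξ : ∀ i, IsClosedConvex (ξ i)) {x p : Fin N → Vec n}
    (hx : ∀ i, x i ∈ dom (ξ i)) : lagrangian W ξ f x p =
      ((∑ i, realCost ξ f i (x i) + ∑ i, inner ℝ (p i) (blockMap W x i) : ℝ) : EReal) := by
  rw [lagrangian, totalCost_eq_coe hξ hx, ← EReal.coe_add, PiLp.inner_apply]
  rfl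

theorem HasSaddlePoint.exists_isMultiplier (h : HasSaddlePoint W ξ f)
    (hW : IsCommunicationMatrix G W) (hG : G.Connected) (hξ : ∀ i, IsClosedConvex (ξ i))
    (hdom : ∀ i, xs ∈ dom (ξ i))
    (hmin : ∀ z, (∀ i, z ∈ dom (ξ i)) → ∑ i, realCost ξ f i xs ≤ ∑ i, realCost ξ f i z) :
    ∃ p, IsMultiplier W ξ f xs p := by
  obtain ⟨x', p', hs⟩ := h
  have hx' : ∀ i, x' i ∈ dom (ξ i) := by
    refine mem_dom_of_totalCost_ne_top (f := f) hξ fun htop => ?_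
    have h1 := (hs (fun _ => xs) 0).2
    rw [lagrangian_eq_coe hξ (x := fun _ => xs) hdom, lagrangian, htop, EReal.top_add_coe,
      top_le_iff] at h1
    exact EReal.coe_ne_top _ h1
  have hp : ∀ p : Fin N → Vec n, ∑ i, inner ℝ (p i) (blockMap W x' i) ≤
      ∑ i, inner ℝ (p' i) (blockMap W x' i) := by
    intro p
    have h1 := (hs x' p).1
    rw [lagrangian_eq_coe hξ hx', lagrangian_eq_coe hξ hx', EReal.coe_le_coe_iff] at h1
    linarith
  have hW0 : blockMap W x' = 0 := by
    -- Maximality of `p'`, tested in the direction of the residual, forces the residual to vanish.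
    have h1 := hp (p' + blockMap W x')
    simp only [Pi.add_apply, inner_add_left, Finset.sum_add_distrib,
      real_inner_self_eq_norm_sq] at h1
    have h2 : ∑ i, ‖blockMap W x' i‖ ^ 2 = 0 :=
      le_antisymm (by linarith) (Finset.sum_nonneg fun i _ => sq_nonneg _)
    ext1 i
    have := (Finset.sum_eq_zero_iff_of_nonneg fun i _ => sq_nonneg _).1 h2 i (Finset.mem_univ i)
    simpa using this
  obtain ⟨i₀⟩ := hG.nonempty
  have hc : ∀ i, x' i = x' i₀ := fun i => hW.eq_of_blockMap_eq_zero hG hW0 i i₀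
  refine ⟨p', fun x hx => ?_⟩
  have h1 := (hs x 0).2
  rw [lagrangian_eq_coe hξ hx', lagrangian_eq_coe hξ hx, EReal.coe_le_coe_iff, hW0] at h1
  have h2 := hmin (x' i₀) fun i => hc i ▸ hx' i
  simp only [hc, Pi.zero_apply, inner_zero_right, Finset.sum_const_zero, add_zero] at h1
  exact h2.trans h1

theorem exists_sum_inner_eq (l : (Fin N → Vec n) →ₗ[ℝ] ℝ) :
    ∃ p : Fin N → Vec n, ∀ y, l y = ∑ i, inner ℝ (p i) (y i) := by
  refine ⟨fun i => (InnerProductSpace.toDual ℝ (Vec n)).symm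
    (LinearMap.toContinuousLinearMap (l ∘ₗ LinearMap.single ℝ (fun _ => Vec n) i)), fun y => ?_⟩
  simp only [InnerProductSpace.toDual_symm_apply]
  conv_lhs => rw [← Finset.univ_sum_single y, map_sum]
  rfl

/-- Separate the origin from the pairs (residual, strict upper bound on excess cost). The separating
functional is nonvertical thanks to the relative interior point, and dividing by its cost
coefficient gives the multiplier. -/
theorem exists_isMultiplier_of_slater (hW : IsCommunicationMatrix G W) (hG : G.Connected)
    (hξ : ∀ i, IsClosedConvex (ξ i)) (hf : ∀ i, ConvexOn ℝ Set.univ (f i))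
    (hmin : ∀ z, (∀ i, z ∈ dom (ξ i)) → ∑ i, realCost ξ f i xs ≤ ∑ i, realCost ξ f i z)
    (hs : (⋂ i, intrinsicInterior ℝ (dom (ξ i))).Nonempty) :
    ∃ p, IsMultiplier W ξ f xs p := by
  obtain ⟨z, hz⟩ := hs
  rw [Set.mem_iInter] at hz
  have hzd : ∀ i, z ∈ dom (ξ i) := fun i => intrinsicInterior_subset (hz i)
  set Fs := ∑ i, realCost ξ f i xs with hFs
  let C : Set ((Fin N → Vec n) × ℝ) := {q | ∃ x : Fin N → Vec n, (∀ i, x i ∈ dom (ξ i)) ∧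
    q.1 = blockMap W x ∧ ∑ i, realCost ξ f i (x i) - Fs < q.2}
  have hmemC : ∀ x : Fin N → Vec n, (∀ i, x i ∈ dom (ξ i)) → ∀ r,
      ∑ i, realCost ξ f i (x i) - Fs < r → (blockMap W x, r) ∈ C :=
    fun x hx r hr => ⟨x, hx, rfl, hr⟩
  have hCconv : Convex ℝ C := by
    rw [convex_iff_forall_pos]
    rintro ⟨y₁, r₁⟩ ⟨x₁, hx₁, hy₁, hr₁⟩ ⟨y₂, r₂⟩ ⟨x₂, hx₂, hy₂, hr₂⟩ a b ha hb hab
    simp only at hy₁ hr₁ hy₂ hr₂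
    refine ⟨a • x₁ + b • x₂, fun i => (hξ i).convexOn.1 (hx₁ i) (hx₂ i) ha.le hb.le hab, ?_, ?_⟩
    · simp [hy₁, hy₂]
    · have h1 : ∑ i, realCost ξ f i ((a • x₁ + b • x₂) i) ≤
          a * ∑ i, realCost ξ f i (x₁ i) + b * ∑ i, realCost ξ f i (x₂ i) := by
        rw [Finset.mul_sum, Finset.mul_sum, ← Finset.sum_add_distrib]
        exact Finset.sum_le_sum fun i _ =>
          (convexOn_realCost hξ hf i).2 (hx₁ i) (hx₂ i) ha.le hb.le hab
      have h2 := mul_lt_mul_of_pos_left hr₁ ha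
      have h3 := mul_lt_mul_of_pos_left hr₂ hb
      have h4 : a * Fs + b * Fs = Fs := by rw [← add_mul, hab, one_mul]
      simp only [Prod.snd_add, Prod.smul_snd, smul_eq_mul]
      linarith
  have hC0 : (0 : (Fin N → Vec n) × ℝ) ∉ C := by
    rintro ⟨x, hx, hy, hr⟩
    obtain ⟨i₀⟩ := hG.nonempty
    have hc : ∀ i, x i = x i₀ := fun i => hW.eq_of_blockMap_eq_zero hG hy.symm i i₀
    have h1 := hmin (x i₀) fun i => hc i ▸ hx i
    simp only [hc, Prod.snd_zero] at hr
    linarith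
  obtain ⟨l, hl, ⟨q₀, hq₀, hlq₀⟩⟩ := exists_linear_nonneg_of_zero_notMem hCconv
    ⟨_, hmemC (fun _ => z) hzd _ (lt_add_one _)⟩ hC0
  obtain ⟨p, hp⟩ := exists_sum_inner_eq (l ∘ₗ LinearMap.inl ℝ (Fin N → Vec n) ℝ)
  set β := l (0, 1) with hβ
  have hlp : ∀ y r, l (y, r) = ∑ i, inner ℝ (p i) (y i) + r * β := by
    intro y r
    rw [← hp, hβ, ← smul_eq_mul, ← map_smul, LinearMap.comp_apply, ← map_add]
    simp
  have hβ0 : 0 ≤ β := by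
    by_contra hneg
    push Not at hneg
    set r₀ := ∑ i, realCost ξ f i z - Fs + 1 with hr₀
    have h1 := hl _ (hmemC (fun _ => z) hzd (max r₀ 1)
      (lt_of_lt_of_le (lt_add_one _) (le_max_left _ _)))
    rw [hlp, hW.blockMap_const] at h1
    simp only [Pi.zero_apply, inner_zero_right, Finset.sum_const_zero, zero_add] at h1
    have h2 : 0 < max r₀ 1 := lt_of_lt_of_le one_pos (le_max_right _ _)
    nlinarith
  rcases hβ0.eq_or_lt with h0 | hpos
  -- If `β = 0`, moving `z` slightly away from `x` reverses the sign of the residual, which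
  -- contradicts strict positivity at `q₀`.
  · exfalso
    obtain ⟨x, hx, hy, hr⟩ := hq₀
    have hev : ∀ᶠ ε : ℝ in nhds 0, ∀ i, z + ε • (z - x i) ∈ dom (ξ i) :=
      Filter.eventually_all.2 fun i =>
        eventually_add_smul_mem_of_mem_intrinsicInterior (hz i) (hx i)
    obtain ⟨ε, hε, hεpos⟩ := ((hev.filter_mono nhdsWithin_le_nhds).and
      (self_mem_nhdsWithin : Set.Ioi (0 : ℝ) ∈ nhdsWithin 0 (Set.Ioi 0))).exists
    have h1 := hl _ (hmemC (fun i => z + ε • (z - x i)) hε _ (lt_add_one _))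
    have h2 : blockMap W (fun i => z + ε • (z - x i)) = -ε • blockMap W x := by
      have : (fun i => z + ε • (z - x i)) =
          (fun _ => z) + ε • ((fun _ => z) - x) := rfl
      rw [this, map_add, map_smul, map_sub, hW.blockMap_const]
      simp
    rw [hlp, h2, ← h0] at h1
    have h3 : q₀ = (q₀.1, q₀.2) := rfl
    rw [h3, hlp, ← h0, hy] at hlq₀
    simp only [Pi.smul_apply, inner_smul_right, ← Finset.mul_sum, mul_zero, add_zero] at h1 hlq₀
    have hε' : 0 < ε := hεpos
    nlinarith
  · refine ⟨fun i => β⁻¹ • p i, fun x hx => le_of_forall_pos_le_add fun δ hδ => ?_⟩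
    have h1 := hl _ (hmemC x hx (∑ i, realCost ξ f i (x i) - Fs + δ) (by linarith))
    rw [hlp] at h1
    simp only [inner_smul_left, ← Finset.mul_sum]
    have h2 : 0 ≤ β⁻¹ * (∑ i, inner ℝ (p i) (blockMap W x i) +
        (∑ i, realCost ξ f i (x i) - Fs + δ) * β) := mul_nonneg (by positivity) h1
    have h3 : β⁻¹ * (∑ i, inner ℝ (p i) (blockMap W x i) +
        (∑ i, realCost ξ f i (x i) - Fs + δ) * β) =
        β⁻¹ * ∑ i, inner ℝ (p i) (blockMap W x i) + (∑ i, realCost ξ f i (x i) - Fs + δ) := by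
      field_simp
    rw [h3] at h2
    simp only [map_inv₀, conj_trivial]
    linarith

/-- Perturb only block `i` of the consensus vector; the residual then depends on `y - xs` alone. -/
theorem IsMultiplier.neg_mem_subdiff {p : Fin N → Vec n} (hp : IsMultiplier W ξ f xs p)
    (hW : IsCommunicationMatrix G W) (hξ : ∀ i, IsClosedConvex (ξ i))
    (hdom : ∀ i, xs ∈ dom (ξ i)) (i : Fin N) :
    -blockMap W.transpose p i ∈ subdiff (localCost (ξ i) (f i)) xs := by
  intro y
  by_cases hy : y ∈ dom (ξ i)
  · rw [localCost_eq_coe hξ hy, localCost_eq_coe hξ (hdom i), ← EReal.coe_add,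
      EReal.coe_le_coe_iff]
    have h1 := hp (Function.update (fun _ => xs) i y) fun j => by
      by_cases hj : j = i
      · subst hj; simpa using hy
      · simpa [hj] using hdom j
    have h2 : blockMap W (Function.update (fun _ => xs) i y) =
        blockMap W (Pi.single i (y - xs)) := by
      have e : Function.update (fun _ => xs) i y = (fun _ => xs) + Pi.single i (y - xs) := by
        ext1 j
        by_cases hj : j = i
        · subst hj; simp
        · simp [hj]
      rw [e, map_add, hW.blockMap_const, zero_add]
    rw [h2, sum_inner_blockMap, Finset.sum_eq_single (a := i)
      (f := fun j => inner ℝ (blockMap W.transpose p j) ((Pi.single i (y - xs) : Fin N → Vec n) j))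
      (fun j _ hj => by simp [hj]) (by simp), Pi.single_eq_same,
      ← Finset.add_sum_erase _ _ (Finset.mem_univ i),
      ← Finset.add_sum_erase (a := i) (f := fun j => realCost ξ f j _) _ (Finset.mem_univ i),
      Function.update_self] at h1
    have h3 : ∑ j ∈ Finset.univ.erase i,
        realCost ξ f j (Function.update (fun _ => xs) i y j) =
        ∑ j ∈ Finset.univ.erase i, realCost ξ f j xs := Finset.sum_congr rfl fun j hj => by
      rw [Function.update_of_ne (Finset.ne_of_mem_erase hj)]
    rw [inner_neg_left]
    linarith
  · rw [localCost_eq_top hy]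
    exact le_top

theorem IsMultiplier.exists_norm_sq_le {p : Fin N → Vec n} (hp : IsMultiplier W ξ f xs p)
    (hW : IsCommunicationMatrix G W) (hξ : ∀ i, IsClosedConvex (ξ i))
    (hdom : ∀ i, xs ∈ dom (ξ i)) {κ : Fin N → ℝ}
    (hκ : ∀ i, ∀ q ∈ subdiff (localCost (ξ i) (f i)) xs, ‖q‖ ≤ κ i) :
    ∃ q, IsMultiplier W ξ f xs q ∧ ∑ i, ‖q i‖ ^ 2 ≤ (∑ i, κ i ^ 2) / sigmaMin W ^ 2 := by
  obtain ⟨q, hq, hqn⟩ := exists_blockMap_transpose_eq_norm_sq_le W p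
  refine ⟨q, hp.congr hq, hqn.trans ?_⟩
  gcongr with i
  simpa using hκ i _ (hp.neg_mem_subdiff hW hξ hdom i)

end Multiplier

/-! ### One step of the algorithm -/

section Descent

variable {n N : ℕ} {G : SimpleGraph (Fin N)} [DecidableRel G.Adj] {W : Matrix (Fin N) (Fin N) ℝ}
  {ξ : Fin N → Vec n → EReal} {f : Fin N → Vec n → ℝ} {γ c : Fin N → ℝ} {L : Fin N → NNReal}
  {x s p : ℕ → Fin N → Vec n}

/-- The consequences of the recursion of DPGA-W on which the convergence analysis rests. -/
structure IsDescentRun (G : SimpleGraph (Fin N)) [DecidableRel G.Adj]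
    (W : Matrix (Fin N) (Fin N) ℝ) (ξ : Fin N → Vec n → EReal) (f : Fin N → Vec n → ℝ)
    (γ c : Fin N → ℝ) (L : Fin N → NNReal) (x s p : ℕ → Fin N → Vec n) : Prop where
  mem_dom : ∀ k i, x (k + 1) i ∈ dom (ξ i)
  descent : ∀ k i, ∀ u ∈ dom (ξ i), realCost ξ f i (x (k + 1) i) +
    inner ℝ (blockMap W.transpose (p k + s k) i) (x (k + 1) i - u) ≤
      realCost ξ f i u + 1 / (2 * c i) * (‖x k i - u‖ ^ 2 - ‖x (k + 1) i - u‖ ^ 2) -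
        (1 / (2 * c i) - L i / 2) * ‖x (k + 1) i - x k i‖ ^ 2
  blockMap_eq : ∀ k i, blockMap W (x (k + 1)) i = tau G γ i • s (k + 1) i
  p_succ : ∀ k i, p (k + 1) i = p k i + s (k + 1) i
  p_zero : ∀ i, p 0 i = 0
  s_zero : ∀ i, s 0 i = 0

/-- Sum of three inequalities: the proximal one at `u`, the descent lemma from `x` to `x'`, and the
gradient inequality at `x`. -/
theorem prox_grad_descent {ξ : Vec n → EReal} {f : Vec n → ℝ} {U : Set (Vec n)} {L : NNReal}
    {c : ℝ} (hξ : IsClosedConvex ξ) (hf : ConvexOn ℝ Set.univ f)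
    (hdiff : ∀ z ∈ U, DifferentiableAt ℝ f z) (hL : LipschitzOnWith L (gradient f) U)
    (hc : 0 < c) {x x' w u : Vec n} (hseg : segment ℝ x x' ⊆ U)
    (hp : IsProx c ξ (x - c • (gradient f x + w)) x') (hu : u ∈ dom ξ) :
    (ξ x').toReal + f x' + inner ℝ w (x' - u) ≤
      (ξ u).toReal + f u + 1 / (2 * c) * (‖x - u‖ ^ 2 - ‖x' - u‖ ^ 2) -
        (1 / (2 * c) - L / 2) * ‖x' - x‖ ^ 2 := by
  have hx : DifferentiableAt ℝ f x := hdiff x (hseg (left_mem_segment ℝ x x'))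
  have h1 := hp.le_add_inner hc hξ hu
  have h2 := le_add_inner_gradient_add_sq hdiff hL hseg
  have h3 := add_inner_gradient_le_of_convexOn hf hx u
  have e1 : x' - (x - c • (gradient f x + w)) = (x' - x) + c • (gradient f x + w) := by abel
  rw [e1, inner_add_left, inner_smul_left, inner_add_left, conj_trivial] at h1
  have e2 : inner ℝ (x' - x) (u - x') =
      (‖x - u‖ ^ 2 - ‖x' - u‖ ^ 2 - ‖x' - x‖ ^ 2) / 2 := by
    have e : x - u = -((x' - x) + (u - x')) := by abel
    rw [e, norm_neg, norm_add_sq_real, norm_sub_rev x' u]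
    ring
  have e3 : inner ℝ (gradient f x) (u - x') =
      inner ℝ (gradient f x) (u - x) - inner ℝ (gradient f x) (x' - x) := by
    rw [← inner_sub_right]
    congr 1
    abel
  have e4 : inner ℝ w (u - x') = -inner ℝ w (x' - u) := by
    rw [← inner_neg_right, neg_sub]
  rw [e2, e3, e4] at h1
  have h4 : (ξ x').toReal ≤ (ξ u).toReal + 1 / (2 * c) *
      (‖x - u‖ ^ 2 - ‖x' - u‖ ^ 2 - ‖x' - x‖ ^ 2) + (inner ℝ (gradient f x) (u - x) -
        inner ℝ (gradient f x) (x' - x) - inner ℝ w (x' - u)) := by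
    refine le_of_mul_le_mul_left (h1.trans_eq ?_) hc
    field_simp
    ring
  nlinarith

theorem IsRun.isDescentRun {U : Fin N → Set (Vec n)} {x₀ : Fin N → Vec n}
    (hW : IsCommunicationMatrix G W) (hξ : ∀ i, IsClosedConvex (ξ i))
    (hf : ∀ i, ConvexOn ℝ Set.univ (f i)) (hU : ∀ i, IsOpen (U i))
    (hdomU : ∀ i, dom (ξ i) ⊆ U i) (hdiff : ∀ i, DifferentiableOn ℝ (f i) (U i))
    (hL : ∀ i, LipschitzOnWith (L i) (gradient (f i)) (U i))
    (hne : ∀ i, (dom (ξ i)).Nonempty) (hγ : ∀ i, 0 < γ i) (hc : ∀ i, 0 < c i)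
    (hx₀ : ∀ i, ∀ y ∈ dom (ξ i), segment ℝ (x₀ i) y ⊆ U i)
    (hrun : IsRun G W ξ f γ c x₀ (fun _ => 0) x s p) : IsDescentRun G W ξ f γ c L x s p := by
  have hmem : ∀ k i, x (k + 1) i ∈ dom (ξ i) := fun k i =>
    (hrun.x_step k i).mem_dom (hc i) (hξ i) (hne i)
  -- Only the first segment needs the hypothesis on `x₀`; later ones join two points of the convex
  -- domain.
  have hseg : ∀ k i, segment ℝ (x k i) (x (k + 1) i) ⊆ U i := by
    intro k i
    cases k with
    | zero => rw [hrun.x_init]; exact hx₀ i _ (hmem 0 i)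
    | succ k => exact ((hξ i).convexOn.1.segment_subset (hmem k i) (hmem (k + 1) i)).trans (hdomU i)
  refine ⟨hmem, fun k i u hu => ?_, fun k i => ?_, hrun.p_step, hrun.p_init, hrun.s_init⟩
  · have h1 := hrun.x_step k i
    have h2 := hW.sum_closedNbhd_transpose (p k + s k) i
    simp only [Pi.add_apply] at h2
    rw [h2] at h1
    exact prox_grad_descent (hξ i) (hf i)
      (fun z hz => (hdiff i).differentiableAt ((hU i).mem_nhds hz)) (hL i) (hc i) (hseg k i) h1 hu
  · rw [hrun.s_step, hW.sum_closedNbhd]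
    exact (smul_inv_smul₀ (tau_pos (G := G) hγ i).ne' _).symm

/-- The Lyapunov function of the analysis. -/
def lyapunov (G : SimpleGraph (Fin N)) [DecidableRel G.Adj] (γ c : Fin N → ℝ)
    (z : Vec n) (q : Fin N → Vec n) (x p : Fin N → Vec n) : ℝ :=
  ∑ i, 1 / (2 * c i) * ‖x i - z‖ ^ 2 + ∑ i, tau G γ i / 2 * ‖p i - q i‖ ^ 2

/-- The Lagrangian gap between `x` and the consensus vector `z`. -/
def lagrangianGap (W : Matrix (Fin N) (Fin N) ℝ) (ξ : Fin N → Vec n → EReal)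
    (f : Fin N → Vec n → ℝ) (z : Vec n) (q x : Fin N → Vec n) : ℝ :=
  ∑ i, realCost ξ f i (x i) - ∑ i, realCost ξ f i z + ∑ i, inner ℝ (q i) (blockMap W x i)

/-- With `s = s k` and `s' = s (k + 1)`, the squared distances of `p` to `q` telescope and `‖s' -
s‖²` is the prediction error. -/
theorem inner_add_eq_norm_sq {E : Type*} [NormedAddCommGroup E] [InnerProductSpace ℝ E]
    (p q s s' : E) : inner ℝ (p + s) s' = inner ℝ q s' +
      1 / 2 * (‖p + s' - q‖ ^ 2 - ‖p - q‖ ^ 2 + ‖s‖ ^ 2 - ‖s' - s‖ ^ 2) := by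
  have e : p + s' - q = (p - q) + s' := by abel
  rw [e, norm_add_sq_real, norm_sub_sq_real s' s, inner_sub_left, inner_add_left,
    real_inner_comm s s']
  ring

theorem IsDescentRun.step (h : IsDescentRun G W ξ f γ c L x s p)
    (hW : IsCommunicationMatrix G W) {z : Vec n} (hz : ∀ i, z ∈ dom (ξ i)) (q : Fin N → Vec n)
    (k : ℕ) :
    lagrangianGap W ξ f z q (x (k + 1)) + lyapunov G γ c z q (x (k + 1)) (p (k + 1)) +
        ∑ i, tau G γ i / 2 * ‖s k i‖ ^ 2 ≤
      lyapunov G γ c z q (x k) (p k) + ∑ i, tau G γ i / 2 * ‖s (k + 1) i - s k i‖ ^ 2 -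
        ∑ i, (1 / (2 * c i) - L i / 2) * ‖x (k + 1) i - x k i‖ ^ 2 := by
  have h1 := Finset.sum_le_sum fun i (_ : i ∈ Finset.univ) => h.descent k i z (hz i)
  have h2 : ∑ i, inner ℝ (blockMap W.transpose (p k + s k) i) (x (k + 1) i - z) =
      ∑ i, (inner ℝ (q i) (blockMap W (x (k + 1)) i) + tau G γ i / 2 *
        (‖p (k + 1) i - q i‖ ^ 2 - ‖p k i - q i‖ ^ 2 + ‖s k i‖ ^ 2 -
          ‖s (k + 1) i - s k i‖ ^ 2)) := by
    have e := sum_inner_blockMap W (p k + s k) (x (k + 1) - fun _ => z)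
    rw [map_sub, hW.blockMap_const, sub_zero] at e
    refine e.symm.trans (Finset.sum_congr rfl fun i _ => ?_)
    rw [h.blockMap_eq, inner_smul_right, inner_smul_right, Pi.add_apply,
      inner_add_eq_norm_sq (p k i) (q i), h.p_succ]
    ring
  simp only [Finset.sum_add_distrib, Finset.sum_sub_distrib, mul_sub, mul_add] at h1 h2
  rw [h2] at h1
  simp only [lagrangianGap, lyapunov]
  simp only [Finset.sum_sub_distrib, sub_mul] at h1 ⊢
  linarith

theorem inv_sub_nonneg_of_step (hc : ∀ i, 0 < c i)
    (hstep : ∀ i, c i * (L i + γ i * colNormSq W i) ≤ 1) (i : Fin N) :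
    0 ≤ 1 / (2 * c i) - L i / 2 - γ i * colNormSq W i / 2 := by
  have h1 : L i + γ i * colNormSq W i ≤ 1 / c i := by
    rw [le_div_iff₀ (hc i), mul_comm]; exact hstep i
  have h2 : 1 / (2 * c i) = 1 / c i / 2 := by
    rw [div_div, mul_comm]
  linarith

theorem colNormSq_nonneg (W : Matrix (Fin N) (Fin N) ℝ) (i : Fin N) : 0 ≤ colNormSq W i :=
  Finset.sum_nonneg fun _ _ => sq_nonneg _

/-- Indices start at one: `s 0 = 0` need not be the scaled residual of `x 0`. -/
theorem IsDescentRun.sum_tau_norm_sub_sq_le (h : IsDescentRun G W ξ f γ c L x s p)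
    (hW : IsCommunicationMatrix G W) (hγ : ∀ i, 0 < γ i) (k : ℕ) :
    ∑ i, tau G γ i / 2 * ‖s (k + 2) i - s (k + 1) i‖ ^ 2 ≤
      ∑ i, γ i * colNormSq W i / 2 * ‖x (k + 2) i - x (k + 1) i‖ ^ 2 := by
  have h1 := hW.sum_norm_blockMap_sq_le hγ (x (k + 2) - x (k + 1))
  have h2 : ∀ i, tau G γ i / 2 * ‖s (k + 2) i - s (k + 1) i‖ ^ 2 =
      1 / 2 * ((tau G γ i)⁻¹ * ‖blockMap W (x (k + 2) - x (k + 1)) i‖ ^ 2) := by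
    intro i
    have ht := tau_pos (G := G) hγ i
    rw [map_sub, Pi.sub_apply, h.blockMap_eq, h.blockMap_eq, ← smul_sub, norm_smul, mul_pow,
      Real.norm_eq_abs, sq_abs]
    field_simp
  have h3 : ∀ i, γ i * colNormSq W i / 2 * ‖x (k + 2) i - x (k + 1) i‖ ^ 2 =
      1 / 2 * (γ i * colNormSq W i * ‖(x (k + 2) - x (k + 1)) i‖ ^ 2) := by
    intro i
    rw [Pi.sub_apply]
    ring
  simp only [h2, h3, ← Finset.mul_sum]
  linarith

theorem IsDescentRun.fejer (h : IsDescentRun G W ξ f γ c L x s p)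
    (hW : IsCommunicationMatrix G W) (hγ : ∀ i, 0 < γ i) {z : Vec n}
    (hz : ∀ i, z ∈ dom (ξ i)) (q : Fin N → Vec n) (k : ℕ) :
    lagrangianGap W ξ f z q (x (k + 2)) + lyapunov G γ c z q (x (k + 2)) (p (k + 2)) +
        ∑ i, tau G γ i / 2 * ‖s (k + 1) i‖ ^ 2 +
        ∑ i, (1 / (2 * c i) - L i / 2 - γ i * colNormSq W i / 2) *
          ‖x (k + 2) i - x (k + 1) i‖ ^ 2 ≤
      lyapunov G γ c z q (x (k + 1)) (p (k + 1)) := by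
  have h1 := h.step hW hz q (k + 1)
  have h2 := h.sum_tau_norm_sub_sq_le hW hγ k
  simp only [sub_mul, Finset.sum_sub_distrib] at h1 ⊢
  linarith

/-- The first step leaves the uncontrolled error `‖s 1‖²`, which is cancelled by the term in `‖s
1‖²` gained at the second step. -/
theorem IsDescentRun.sum_lagrangianGap_le (h : IsDescentRun G W ξ f γ c L x s p)
    (hW : IsCommunicationMatrix G W) (hγ : ∀ i, 0 < γ i) (hc : ∀ i, 0 < c i)
    (hstep : ∀ i, c i * (L i + γ i * colNormSq W i) ≤ 1) {z : Vec n}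
    (hz : ∀ i, z ∈ dom (ξ i)) (q : Fin N → Vec n) (t : ℕ) :
    ∑ k ∈ Finset.range (t + 1), lagrangianGap W ξ f z q (x (k + 1)) ≤
      lyapunov G γ c z q (x 0) (p 0) := by
  have hη := inv_sub_nonneg_of_step hc hstep
  have hτ : ∀ i, 0 < tau G γ i := tau_pos hγ
  have hfirst : lagrangianGap W ξ f z q (x 1) + lyapunov G γ c z q (x 1) (p 1) ≤
      lyapunov G γ c z q (x 0) (p 0) + ∑ i, tau G γ i / 2 * ‖s 1 i‖ ^ 2 := by
    have h1 := h.step hW hz q 0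
    simp only [h.s_zero, sub_zero, norm_zero, zero_add, ne_eq, OfNat.ofNat_ne_zero,
      not_false_eq_true, zero_pow, mul_zero, Finset.sum_const_zero, add_zero] at h1
    have h2 : 0 ≤ ∑ i, (1 / (2 * c i) - L i / 2) * ‖x 1 i - x 0 i‖ ^ 2 :=
      Finset.sum_nonneg fun i _ => mul_nonneg (by
        have := mul_nonneg (hγ i).le (colNormSq_nonneg W i)
        linarith [hη i]) (sq_nonneg _)
    linarith
  have hnext : ∀ k, lagrangianGap W ξ f z q (x (k + 2)) +
      lyapunov G γ c z q (x (k + 2)) (p (k + 2)) + ∑ i, tau G γ i / 2 * ‖s (k + 1) i‖ ^ 2 ≤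
      lyapunov G γ c z q (x (k + 1)) (p (k + 1)) := fun k => by
    have h1 := h.fejer hW hγ hz q k
    have h2 : 0 ≤ ∑ i, (1 / (2 * c i) - L i / 2 - γ i * colNormSq W i / 2) *
        ‖x (k + 2) i - x (k + 1) i‖ ^ 2 :=
      Finset.sum_nonneg fun i _ => mul_nonneg (hη i) (sq_nonneg _)
    linarith
  have hsum : ∀ t, ∑ k ∈ Finset.range (t + 2), lagrangianGap W ξ f z q (x (k + 1)) +
      lyapunov G γ c z q (x (t + 2)) (p (t + 2)) ≤ lyapunov G γ c z q (x 0) (p 0) := by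
    intro t
    induction t with
    | zero =>
      have := hnext 0
      simp only [Finset.sum_range_succ, Finset.sum_range_zero, zero_add] at this ⊢
      norm_num at this ⊢
      linarith
    | succ t ih =>
      rw [Finset.sum_range_succ]
      have h1 := hnext (t + 1)
      have h2 : 0 ≤ ∑ i, tau G γ i / 2 * ‖s (t + 1 + 1) i‖ ^ 2 :=
        Finset.sum_nonneg fun i _ => mul_nonneg (half_pos (hτ i)).le (sq_nonneg _)
      have e : t + 1 + 2 = t + 2 + 1 := rfl
      have e' : t + 1 + 1 = t + 2 := rfl
      rw [e] at h1 ⊢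
      rw [e'] at h1 h2
      linarith
  have hlyap : ∀ k, 0 ≤ lyapunov G γ c z q (x k) (p k) := fun k =>
    add_nonneg (Finset.sum_nonneg fun i _ => by have := hc i; positivity)
      (Finset.sum_nonneg fun i _ => mul_nonneg (half_pos (hτ i)).le (sq_nonneg _))
  cases t with
  | succ t => linarith [hsum t, hlyap (t + 2)]
  | zero =>
    -- With a single step there is no later gain. As `z` has zero residual, `s 1` is the scaled
    -- residual of `x 1 - z`, so the distance of `x 1` to `z` pays for the error.
    have h1 : ∑ i, tau G γ i / 2 * ‖s 1 i‖ ^ 2 ≤ lyapunov G γ c z q (x 1) (p 1) := by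
      have h2 := hW.sum_norm_blockMap_sq_le hγ (x 1 - fun _ => z)
      have h3 : ∀ i, tau G γ i / 2 * ‖s 1 i‖ ^ 2 =
          1 / 2 * ((tau G γ i)⁻¹ * ‖blockMap W (x 1 - fun _ => z) i‖ ^ 2) := by
        intro i
        have ht := hτ i
        rw [map_sub, hW.blockMap_const, sub_zero, h.blockMap_eq 0 i, norm_smul, mul_pow,
          Real.norm_eq_abs, sq_abs]
        field_simp
      have h4 : 1 / 2 * ∑ i, γ i * colNormSq W i * ‖(x 1 - fun _ => z : Fin N → Vec n) i‖ ^ 2 ≤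
          ∑ i, 1 / (2 * c i) * ‖x 1 i - z‖ ^ 2 := by
        rw [Finset.mul_sum]
        refine Finset.sum_le_sum fun i _ => ?_
        rw [← mul_assoc, Pi.sub_apply]
        refine mul_le_mul_of_nonneg_right ?_ (sq_nonneg _)
        have := (L i).coe_nonneg
        linarith [hη i]
      have h5 : 0 ≤ ∑ i, tau G γ i / 2 * ‖p 1 i - q i‖ ^ 2 :=
        Finset.sum_nonneg fun i _ => mul_nonneg (half_pos (hτ i)).le (sq_nonneg _)
      simp only [h3, ← Finset.mul_sum, lyapunov]
      linarith
    simp only [zero_add, Finset.sum_range_one]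
    linarith

/-! ### Ergodic rates -/

theorem avg_eq_sum_range (x : ℕ → Fin N → Vec n) (t : ℕ) :
    avg x t = ∑ k ∈ Finset.range t, (1 / (t : ℝ)) • x (k + 1) := by
  ext1 i
  have h : Finset.Icc 1 t = Finset.Ico (0 + 1) (t + 1) := by
    ext k
    simp only [Finset.mem_Icc, Finset.mem_Ico]
    omega
  rw [avg, ← Finset.smul_sum, Pi.smul_apply, Finset.sum_apply, h, Finset.range_eq_Ico,
    Finset.sum_Ico_add' (fun k => x k i)]

theorem IsDescentRun.avg_mem_dom (h : IsDescentRun G W ξ f γ c L x s p)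
    (hξ : ∀ i, IsClosedConvex (ξ i)) {t : ℕ} (ht : 1 ≤ t) (i : Fin N) :
    avg x t i ∈ dom (ξ i) := by
  have ht' : (0 : ℝ) < t := by exact_mod_cast ht
  rw [avg_eq_sum_range, Finset.sum_apply]
  exact (hξ i).convexOn.1.sum_mem (fun _ _ => by positivity) (by simp [ht'.ne'])
    fun k _ => h.mem_dom k i

theorem IsDescentRun.lagrangianGap_avg_le (h : IsDescentRun G W ξ f γ c L x s p)
    (hW : IsCommunicationMatrix G W) (hξ : ∀ i, IsClosedConvex (ξ i))
    (hf : ∀ i, ConvexOn ℝ Set.univ (f i)) (hγ : ∀ i, 0 < γ i) (hc : ∀ i, 0 < c i)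
    (hstep : ∀ i, c i * (L i + γ i * colNormSq W i) ≤ 1) {z : Vec n}
    (hz : ∀ i, z ∈ dom (ξ i)) (q : Fin N → Vec n) {t : ℕ} (ht : 1 ≤ t) :
    lagrangianGap W ξ f z q (avg x t) ≤
      1 / (t : ℝ) * (initConst c (x 0) z + ∑ i, tau G γ i / 2 * ‖q i‖ ^ 2) := by
  have ht' : (0 : ℝ) < t := by exact_mod_cast ht
  have h0 : lyapunov G γ c z q (x 0) (p 0) =
      initConst c (x 0) z + ∑ i, tau G γ i / 2 * ‖q i‖ ^ 2 := by
    simp [lyapunov, initConst, h.p_zero]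
  have h1 := h.sum_lagrangianGap_le hW hγ hc hstep hz q (t - 1)
  rw [Nat.sub_add_cancel ht, h0] at h1
  have h2 : ∑ i, realCost ξ f i (avg x t i) ≤
      ∑ k ∈ Finset.range t, 1 / (t : ℝ) * ∑ i, realCost ξ f i (x (k + 1) i) := by
    simp only [Finset.mul_sum]
    rw [Finset.sum_comm]
    refine Finset.sum_le_sum fun i _ => ?_
    rw [avg_eq_sum_range, Finset.sum_apply]
    exact (convexOn_realCost hξ hf i).map_sum_le (fun _ _ => by positivity) (by simp [ht'.ne'])
      fun k _ => h.mem_dom k i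
  have h3 : ∑ i, inner ℝ (q i) (blockMap W (avg x t) i) =
      ∑ k ∈ Finset.range t, 1 / (t : ℝ) * ∑ i, inner ℝ (q i) (blockMap W (x (k + 1)) i) := by
    simp only [Finset.mul_sum]
    rw [avg_eq_sum_range, Finset.sum_comm]
    refine Finset.sum_congr rfl fun i _ => ?_
    rw [map_sum, Finset.sum_apply, inner_sum]
    refine Finset.sum_congr rfl fun k _ => ?_
    rw [map_smul, Pi.smul_apply, inner_smul_right]
  have h4 : ∑ i, realCost ξ f i z =
      ∑ k ∈ Finset.range t, 1 / (t : ℝ) * ∑ i, realCost ξ f i z := by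
    rw [Finset.sum_const, Finset.card_range, nsmul_eq_mul, ← mul_assoc, mul_one_div_cancel ht'.ne',
      one_mul]
  refine le_trans ?_ (mul_le_mul_of_nonneg_left h1 (by positivity))
  simp only [lagrangianGap] at *
  rw [h3]
  conv_lhs => rw [h4]
  simp only [Finset.mul_sum (Finset.range t), mul_add, mul_sub, Finset.sum_add_distrib,
    Finset.sum_sub_distrib]
  linarith

theorem IsDescentRun.mul_norm_kronApply_avg_le (h : IsDescentRun G W ξ f γ c L x s p)
    (hW : IsCommunicationMatrix G W) (hξ : ∀ i, IsClosedConvex (ξ i))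
    (hf : ∀ i, ConvexOn ℝ Set.univ (f i)) (hγ : ∀ i, 0 < γ i) (hc : ∀ i, 0 < c i)
    (hstep : ∀ i, c i * (L i + γ i * colNormSq W i) ≤ 1) {z : Vec n}
    (hz : ∀ i, z ∈ dom (ξ i)) {q : Fin N → Vec n} (hq : IsMultiplier W ξ f z q) {ρ : ℝ}
    (hρ : 0 ≤ ρ) {t : ℕ} (ht : 1 ≤ t) :
    ρ * ‖kronApply W (avg x t)‖ ≤ 1 / (t : ℝ) * (initConst c (x 0) z +
      tauMax G γ / 2 * (‖(WithLp.toLp 2 q : PiLp 2 fun _ : Fin N => Vec n)‖ + ρ) ^ 2) := by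
  have ht' : (0 : ℝ) < t := by exact_mod_cast ht
  set Q : PiLp 2 (fun _ : Fin N => Vec n) := WithLp.toLp 2 q with hQ
  set y := kronApply W (avg x t) with hy
  -- The unit vector along the residual, or zero if the residual vanishes; hence only `‖v‖ ≤ 1` is
  -- claimed.
  set v := ‖y‖⁻¹ • y with hv
  have hvn : ‖v‖ ≤ 1 := by
    rw [hv, norm_smul, norm_inv, norm_norm]
    exact inv_mul_le_one
  have hvy : inner ℝ v y = ‖y‖ := by
    rw [hv, inner_smul_left, real_inner_self_eq_norm_sq, conj_trivial]
    by_cases h0 : ‖y‖ = 0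
    · simp [h0]
    · field_simp
  have h1 := h.lagrangianGap_avg_le hW hξ hf hγ hc hstep hz (Q + ρ • v).ofLp ht
  have h2 := hq _ (h.avg_mem_dom hξ ht)
  have h3 : ∑ i, inner ℝ ((Q + ρ • v).ofLp i) (blockMap W (avg x t) i) =
      ∑ i, inner ℝ (q i) (blockMap W (avg x t) i) + ρ * ‖y‖ := by
    have e1 : inner ℝ (Q + ρ • v) y = inner ℝ Q y + ρ * ‖y‖ := by
      rw [inner_add_left, inner_smul_left, hvy, conj_trivial]
    rwa [PiLp.inner_apply, PiLp.inner_apply] at e1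
  have h4 : ∑ i, tau G γ i / 2 * ‖(Q + ρ • v).ofLp i‖ ^ 2 ≤
      tauMax G γ / 2 * (‖Q‖ + ρ) ^ 2 := by
    calc ∑ i, tau G γ i / 2 * ‖(Q + ρ • v).ofLp i‖ ^ 2
        ≤ ∑ i, tauMax G γ / 2 * ‖(Q + ρ • v).ofLp i‖ ^ 2 := by
          refine Finset.sum_le_sum fun i _ => mul_le_mul_of_nonneg_right ?_ (sq_nonneg _)
          linarith [tau_le_tauMax (G := G) γ i]
      _ = tauMax G γ / 2 * ‖Q + ρ • v‖ ^ 2 := by rw [← Finset.mul_sum, PiLp.norm_sq_eq_of_L2]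
      _ ≤ tauMax G γ / 2 * (‖Q‖ + ρ) ^ 2 := by
          have h5 : ‖Q + ρ • v‖ ≤ ‖Q‖ + ρ := by
            refine (norm_add_le _ _).trans ?_
            rw [norm_smul, Real.norm_of_nonneg hρ]
            linarith [mul_le_of_le_one_right hρ hvn]
          have h6 : 0 ≤ tauMax G γ := Real.iSup_nonneg fun i => (tau_pos hγ i).le
          gcongr
  rw [lagrangianGap, h3] at h1
  refine le_trans ?_ (mul_le_mul_of_nonneg_left (add_le_add_right h4 _) (by positivity))
  linarith

end Descent

/-! ### Convergence of the iterates -/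

section Convergence

open Filter Topology

variable {n N : ℕ} {G : SimpleGraph (Fin N)} [DecidableRel G.Adj] {W : Matrix (Fin N) (Fin N) ℝ}
  {ξ : Fin N → Vec n → EReal} {f : Fin N → Vec n → ℝ} {γ c : Fin N → ℝ} {L : Fin N → NNReal}
  {x s p : ℕ → Fin N → Vec n}

theorem tendsto_zero_of_mul_norm_sq_le {E : Type*} [NormedAddCommGroup E] {a : ℝ} (ha : 0 < a)
    {w : ℕ → E} {b : ℕ → ℝ} (h : ∀ k, a * ‖w k‖ ^ 2 ≤ b k) (hb : Tendsto b atTop (𝓝 0)) :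
    Tendsto w atTop (𝓝 0) := by
  have h1 : Tendsto (fun k => ‖w k‖ ^ 2) atTop (𝓝 0) := by
    refine squeeze_zero (fun k => sq_nonneg _) (fun k => ?_) (by simpa using hb.div_const a)
    rw [le_div_iff₀ ha, mul_comm]
    exact h k
  have h2 := (Real.continuous_sqrt.tendsto 0).comp h1
  rw [Real.sqrt_zero] at h2
  refine tendsto_zero_iff_norm_tendsto_zero.2 (h2.congr fun k => ?_)
  exact Real.sqrt_sq (norm_nonneg _)

theorem lyapunov_nonneg (hγ : ∀ i, 0 < γ i) (hc : ∀ i, 0 < c i) (z : Vec n)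
    (q x p : Fin N → Vec n) : 0 ≤ lyapunov G γ c z q x p :=
  add_nonneg (Finset.sum_nonneg fun i _ => by have := hc i; positivity)
    (Finset.sum_nonneg fun i _ => mul_nonneg (half_pos (tau_pos hγ i)).le (sq_nonneg _))

theorem mul_norm_sub_sq_le_lyapunov (hγ : ∀ i, 0 < γ i) (hc : ∀ i, 0 < c i) (z : Vec n)
    (q x p : Fin N → Vec n) (i : Fin N) :
    1 / (2 * c i) * ‖x i - z‖ ^ 2 ≤ lyapunov G γ c z q x p ∧
      tau G γ i / 2 * ‖p i - q i‖ ^ 2 ≤ lyapunov G γ c z q x p := by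
  have h1 : ∀ i ∈ Finset.univ, 0 ≤ 1 / (2 * c i) * ‖x i - z‖ ^ 2 := fun i _ => by
    have := hc i; positivity
  have h2 : ∀ i ∈ Finset.univ, 0 ≤ tau G γ i / 2 * ‖p i - q i‖ ^ 2 := fun i _ =>
    mul_nonneg (half_pos (tau_pos hγ i)).le (sq_nonneg _)
  have h3 := Finset.single_le_sum h1 (Finset.mem_univ i)
  have h4 := Finset.single_le_sum h2 (Finset.mem_univ i)
  have h5 := Finset.sum_nonneg h1
  have h6 := Finset.sum_nonneg h2
  rw [lyapunov]
  constructor <;> linarith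

theorem IsDescentRun.lagrangianGap_nonneg (h : IsDescentRun G W ξ f γ c L x s p) {z : Vec n}
    {q : Fin N → Vec n} (hq : IsMultiplier W ξ f z q) (k : ℕ) :
    0 ≤ lagrangianGap W ξ f z q (x (k + 1)) := by
  have := hq _ (h.mem_dom k)
  rw [lagrangianGap]
  linarith

theorem IsDescentRun.antitone_lyapunov (h : IsDescentRun G W ξ f γ c L x s p)
    (hW : IsCommunicationMatrix G W) (hγ : ∀ i, 0 < γ i) (hc : ∀ i, 0 < c i)
    (hstep : ∀ i, c i * (L i + γ i * colNormSq W i) ≤ 1) {z : Vec n}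
    (hz : ∀ i, z ∈ dom (ξ i)) {q : Fin N → Vec n} (hq : IsMultiplier W ξ f z q) :
    Antitone fun k => lyapunov G γ c z q (x (k + 1)) (p (k + 1)) := by
  refine antitone_nat_of_succ_le fun k => ?_
  have h1 := h.fejer hW hγ hz q k
  have h2 := h.lagrangianGap_nonneg hq (k + 1)
  have h3 : 0 ≤ ∑ i, tau G γ i / 2 * ‖s (k + 1) i‖ ^ 2 :=
    Finset.sum_nonneg fun i _ => mul_nonneg (half_pos (tau_pos hγ i)).le (sq_nonneg _)
  have h4 : 0 ≤ ∑ i, (1 / (2 * c i) - L i / 2 - γ i * colNormSq W i / 2) *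
      ‖x (k + 2) i - x (k + 1) i‖ ^ 2 :=
    Finset.sum_nonneg fun i _ => mul_nonneg (inv_sub_nonneg_of_step hc hstep i) (sq_nonneg _)
  have e : k + 1 + 1 = k + 2 := rfl
  rw [e] at h2 ⊢
  linarith

theorem IsDescentRun.tendsto_increments (h : IsDescentRun G W ξ f γ c L x s p)
    (hW : IsCommunicationMatrix G W) (hγ : ∀ i, 0 < γ i) (hc : ∀ i, 0 < c i)
    (hstep : ∀ i, c i * (L i + γ i * colNormSq W i) < 1) {z : Vec n}
    (hz : ∀ i, z ∈ dom (ξ i)) {q : Fin N → Vec n} (hq : IsMultiplier W ξ f z q) (i : Fin N) :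
    Tendsto (fun k => s (k + 1) i) atTop (𝓝 0) ∧
      Tendsto (fun k => x (k + 2) i - x (k + 1) i) atTop (𝓝 0) := by
  have hanti := h.antitone_lyapunov hW hγ hc (fun i => (hstep i).le) hz hq
  set V := fun k => lyapunov G γ c z q (x (k + 1)) (p (k + 1)) with hV
  obtain ⟨l, hl⟩ : ∃ l, Tendsto V atTop (𝓝 l) :=
    ⟨_, tendsto_atTop_ciInf hanti ⟨0, by
      rintro _ ⟨k, rfl⟩; exact lyapunov_nonneg hγ hc _ _ _ _⟩⟩
  have hdiff : Tendsto (fun k => V k - V (k + 1)) atTop (𝓝 0) := by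
    simpa using hl.sub ((tendsto_add_atTop_iff_nat 1).2 hl)
  have hη : ∀ i, 0 < 1 / (2 * c i) - L i / 2 - γ i * colNormSq W i / 2 := by
    intro i
    have h1 : L i + γ i * colNormSq W i < 1 / c i := by
      rw [lt_div_iff₀ (hc i), mul_comm]; exact hstep i
    have h2 : 1 / (2 * c i) = 1 / c i / 2 := by
      rw [div_div, mul_comm]
    linarith
  have hR : ∀ k, ∀ i ∈ Finset.univ, 0 ≤ tau G γ i / 2 * ‖s (k + 1) i‖ ^ 2 := fun k i _ =>
    mul_nonneg (half_pos (tau_pos hγ i)).le (sq_nonneg _)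
  have hD : ∀ k, ∀ i ∈ Finset.univ, 0 ≤ (1 / (2 * c i) - L i / 2 - γ i * colNormSq W i / 2) *
      ‖x (k + 2) i - x (k + 1) i‖ ^ 2 := fun k i _ => mul_nonneg (hη i).le (sq_nonneg _)
  have hle : ∀ k, ∑ i, tau G γ i / 2 * ‖s (k + 1) i‖ ^ 2 +
        ∑ i, (1 / (2 * c i) - L i / 2 - γ i * colNormSq W i / 2) *
          ‖x (k + 2) i - x (k + 1) i‖ ^ 2 ≤ V k - V (k + 1) := fun k => by
    have h1 := h.fejer hW hγ hz q k
    have h2 := h.lagrangianGap_nonneg hq (k + 1)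
    have e : k + 1 + 1 = k + 2 := rfl
    simp only [hV, e] at h2 ⊢
    linarith
  constructor
  · refine tendsto_zero_of_mul_norm_sq_le (half_pos (tau_pos (G := G) hγ i)) (fun k => ?_) hdiff
    have h1 := Finset.single_le_sum (hR k) (Finset.mem_univ i)
    have h2 := Finset.sum_nonneg (hD k)
    linarith [hle k]
  · refine tendsto_zero_of_mul_norm_sq_le (hη i) (fun k => ?_) hdiff
    have h1 := Finset.single_le_sum (hD k) (Finset.mem_univ i)
    have h2 := Finset.sum_nonneg (hR k)
    linarith [hle k]

theorem IsDescentRun.exists_subseq_tendsto (h : IsDescentRun G W ξ f γ c L x s p)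
    (hW : IsCommunicationMatrix G W) (hγ : ∀ i, 0 < γ i) (hc : ∀ i, 0 < c i)
    (hstep : ∀ i, c i * (L i + γ i * colNormSq W i) ≤ 1) {z : Vec n}
    (hz : ∀ i, z ∈ dom (ξ i)) {q : Fin N → Vec n} (hq : IsMultiplier W ξ f z q) :
    ∃ (x' p' : Fin N → Vec n) (φ : ℕ → ℕ), StrictMono φ ∧
      Tendsto (fun k => x (φ k + 1)) atTop (𝓝 x') ∧
      Tendsto (fun k => p (φ k + 1)) atTop (𝓝 p') := by
  have hanti := h.antitone_lyapunov hW hγ hc hstep hz hq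
  set V := fun k => lyapunov G γ c z q (x (k + 1)) (p (k + 1)) with hV
  have hmem : ∀ {E : Type} [NormedAddCommGroup E] {a : ℝ} (_ : 0 < a) {w y : E},
      a * ‖w - y‖ ^ 2 ≤ V 0 → w ∈ Metric.closedBall y (√(V 0 / a)) := by
    intro E _ a ha w y hw
    rw [mem_closedBall_iff_norm]
    refine Real.le_sqrt_of_sq_le ?_
    rwa [le_div_iff₀ ha, mul_comm]
  have hx : ∀ k i, x (k + 1) i ∈ Metric.closedBall z (√(V 0 / (1 / (2 * c i)))) := fun k i =>
    hmem (by have := hc i; positivity)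
      ((mul_norm_sub_sq_le_lyapunov hγ hc z q _ _ i).1.trans (hanti (Nat.zero_le k)))
  have hp : ∀ k i, p (k + 1) i ∈ Metric.closedBall (q i) (√(V 0 / (tau G γ i / 2))) := fun k i =>
    hmem (half_pos (tau_pos hγ i))
      ((mul_norm_sub_sq_le_lyapunov hγ hc z q _ _ i).2.trans (hanti (Nat.zero_le k)))
  have hb := (Bornology.IsBounded.pi fun i : Fin N =>
      (Metric.isBounded_closedBall (x := z) (r := √(V 0 / (1 / (2 * c i)))))).prod
    (Bornology.IsBounded.pi fun i : Fin N =>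
      (Metric.isBounded_closedBall (x := q i) (r := √(V 0 / (tau G γ i / 2)))))
  obtain ⟨⟨x', p'⟩, _, φ, hφ, hlim⟩ := tendsto_subseq_of_bounded hb
    (x := fun k => (x (k + 1), p (k + 1))) fun k =>
      ⟨fun i _ => hx k i, fun i _ => hp k i⟩
  exact ⟨x', p', φ, hφ, (continuous_fst.tendsto _).comp hlim, (continuous_snd.tendsto _).comp hlim⟩

theorem continuous_blockMap (A : Matrix (Fin N) (Fin N) ℝ) :
    Continuous (blockMap (n := n) A) :=
  LinearMap.continuous_of_finiteDimensional _

/-- Pass to the limit in the descent inequality, where the vanishing increments remove the distance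
terms; `s → 0` makes the limit a consensus vector. -/
theorem IsDescentRun.isMultiplier_of_tendsto (h : IsDescentRun G W ξ f γ c L x s p)
    (hW : IsCommunicationMatrix G W) (hG : G.Connected) (hξ : ∀ i, IsClosedConvex (ξ i))
    (hf : ∀ i, ConvexOn ℝ Set.univ (f i)) (hγ : ∀ i, 0 < γ i) (hc : ∀ i, 0 < c i)
    (hstep : ∀ i, c i * (L i + γ i * colNormSq W i) < 1) {z : Vec n}
    (hz : ∀ i, z ∈ dom (ξ i)) {q : Fin N → Vec n} (hq : IsMultiplier W ξ f z q)
    {x' p' : Fin N → Vec n} {φ : ℕ → ℕ} (hφ : StrictMono φ)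
    (hx' : Tendsto (fun k => x (φ k + 1)) atTop (𝓝 x'))
    (hp' : Tendsto (fun k => p (φ k + 1)) atTop (𝓝 p')) :
    ∃ z', x' = (fun _ => z') ∧ (∀ i, z' ∈ dom (ξ i)) ∧ IsMultiplier W ξ f z' p' := by
  have hinc := h.tendsto_increments hW hγ hc hstep hz hq
  have hs : Tendsto (fun k => s (φ k + 1)) atTop (𝓝 0) :=
    tendsto_pi_nhds.2 fun i => (hinc i).1.comp hφ.tendsto_atTop
  have hx2 : Tendsto (fun k => x (φ k + 2)) atTop (𝓝 x') := by
    have h1 : Tendsto (fun k => x (φ k + 2) - x (φ k + 1)) atTop (𝓝 0) :=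
      tendsto_pi_nhds.2 fun i => (hinc i).2.comp hφ.tendsto_atTop
    simpa using h1.add hx'
  have hWx : blockMap W x' = 0 := by
    refine tendsto_nhds_unique (((continuous_blockMap W).tendsto x').comp hx')
      (tendsto_pi_nhds.2 fun i => ?_)
    have h1 : Tendsto (fun k => tau G γ i • s (φ k + 1) i) atTop (𝓝 (tau G γ i • 0)) :=
      ((tendsto_pi_nhds.1 hs i)).const_smul _
    rw [smul_zero] at h1
    exact h1.congr fun k => (h.blockMap_eq (φ k) i).symm
  obtain ⟨i₀⟩ := hG.nonempty
  have hcons : x' = fun _ => x' i₀ :=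
    funext fun i => hW.eq_of_blockMap_eq_zero hG hWx i i₀
  set w := blockMap W.transpose p' with hw
  have hwlim : Tendsto (fun k => blockMap W.transpose (p (φ k + 1) + s (φ k + 1))) atTop (𝓝 w) := by
    have h1 := hp'.add hs
    rw [add_zero] at h1
    exact ((continuous_blockMap W.transpose).tendsto p').comp h1
  have hlim : ∀ i, ∀ u ∈ dom (ξ i), x' i ∈ dom (ξ i) ∧
      realCost ξ f i (x' i) + inner ℝ (w i) (x' i - u) ≤ realCost ξ f i u := by
    intro i u hu
    have hfc : Continuous (f i) := continuousOn_univ.1 ((hf i).continuousOn isOpen_univ)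
    have hxi := tendsto_pi_nhds.1 hx' i
    have hx2i := tendsto_pi_nhds.1 hx2 i
    have hwi := tendsto_pi_nhds.1 hwlim i
    -- Everything except `ξ i` is continuous and goes into `r`, since `ξ i` is only lower
    -- semicontinuous.
    let r : ℕ → ℝ := fun k => realCost ξ f i u - f i (x (φ k + 2) i) -
      inner ℝ (blockMap W.transpose (p (φ k + 1) + s (φ k + 1)) i) (x (φ k + 2) i - u) +
      1 / (2 * c i) * (‖x (φ k + 1) i - u‖ ^ 2 - ‖x (φ k + 2) i - u‖ ^ 2)
    have hr : Tendsto r atTop (𝓝 (realCost ξ f i u - f i (x' i) - inner ℝ (w i) (x' i - u))) := by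
      have h1 := (((hfc.tendsto (x' i)).comp hx2i).const_sub (realCost ξ f i u)).sub
        (hwi.inner (𝕜 := ℝ) (hx2i.sub_const u))
      have h2 := ((((hxi.sub_const u).norm.pow 2).sub
        ((hx2i.sub_const u).norm.pow 2)).const_mul (1 / (2 * c i)))
      have h3 := h1.add h2
      rw [sub_self, mul_zero, add_zero] at h3
      exact h3
    have hle : ∀ k, ξ i (x (φ k + 2) i) ≤ (r k : EReal) := by
      intro k
      rw [← (hξ i).coe_toReal (h.mem_dom (φ k + 1) i), EReal.coe_le_coe_iff]
      have h1 := h.descent (φ k + 1) i u hu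
      have h2 : 0 ≤ (1 / (2 * c i) - L i / 2) * ‖x (φ k + 1 + 1) i - x (φ k + 1) i‖ ^ 2 := by
        refine mul_nonneg ?_ (sq_nonneg _)
        have h3 := inv_sub_nonneg_of_step hc (fun i => (hstep i).le) i
        have h4 := mul_nonneg (hγ i).le (colNormSq_nonneg W i)
        linarith
      simp only [realCost, r] at h1 ⊢
      have e : φ k + 1 + 1 = φ k + 2 := rfl
      rw [e] at h1 h2 ⊢
      linarith
    obtain ⟨h1, h2⟩ := (hξ i).mem_dom_of_tendsto hx2i hr hle
    refine ⟨h1, ?_⟩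
    rw [realCost]
    linarith
  refine ⟨x' i₀, hcons, fun i => ?_, fun y hy => ?_⟩
  · have := (hlim i z (hz i)).1
    rwa [congrFun hcons i] at this
  · have h1 := Finset.sum_le_sum fun i (_ : i ∈ Finset.univ) => (hlim i (y i) (hy i)).2
    have h2 : ∑ i, inner ℝ (w i) (x' i - y i) = -∑ i, inner ℝ (p' i) (blockMap W y i) := by
      have e := sum_inner_blockMap W p' (x' - y)
      rw [map_sub, hWx, zero_sub] at e
      simp only [Pi.neg_apply, inner_neg_right, Finset.sum_neg_distrib] at e
      exact e.symm
    rw [Finset.sum_add_distrib, h2] at h1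
    have h3 : ∑ i, realCost ξ f i (x' i) = ∑ i, realCost ξ f i (x' i₀) :=
      Finset.sum_congr rfl fun i _ => congrArg _ (congrFun hcons i)
    linarith

theorem IsDescentRun.exists_tendsto (h : IsDescentRun G W ξ f γ c L x s p)
    (hW : IsCommunicationMatrix G W) (hG : G.Connected) (hξ : ∀ i, IsClosedConvex (ξ i))
    (hf : ∀ i, ConvexOn ℝ Set.univ (f i)) (hγ : ∀ i, 0 < γ i) (hc : ∀ i, 0 < c i)
    (hstep : ∀ i, c i * (L i + γ i * colNormSq W i) < 1) {z : Vec n}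
    (hz : ∀ i, z ∈ dom (ξ i)) {q : Fin N → Vec n} (hq : IsMultiplier W ξ f z q) :
    ∃ (z' : Vec n) (p' : Fin N → Vec n), (∀ i, z' ∈ dom (ξ i)) ∧ IsMultiplier W ξ f z' p' ∧
      Tendsto x atTop (𝓝 fun _ => z') := by
  have hstep' := fun i => (hstep i).le
  obtain ⟨x', p', φ, hφ, hx', hp'⟩ := h.exists_subseq_tendsto hW hγ hc hstep' hz hq
  obtain ⟨z', rfl, hz', hq'⟩ :=
    h.isMultiplier_of_tendsto hW hG hξ hf hγ hc hstep hz hq hφ hx' hp'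
  refine ⟨z', p', hz', hq', ?_⟩
  -- The Lyapunov function is recentred at the cluster point, where it tends to zero along `φ` and
  -- so along the whole sequence.
  have hanti := h.antitone_lyapunov hW hγ hc hstep' hz' hq'
  have hsub : Tendsto ((fun k => lyapunov G γ c z' p' (x (k + 1)) (p (k + 1))) ∘ φ) atTop
      (𝓝 0) := by
    have h1 : Tendsto (fun k => ∑ i, 1 / (2 * c i) * ‖x (φ k + 1) i - z'‖ ^ 2) atTop
        (𝓝 (∑ i, 1 / (2 * c i) * ‖z' - z'‖ ^ 2)) :=
      tendsto_finsetSum _ fun i _ =>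
        (((tendsto_pi_nhds.1 hx' i).sub_const z').norm.pow 2).const_mul _
    have h2 : Tendsto (fun k => ∑ i, tau G γ i / 2 * ‖p (φ k + 1) i - p' i‖ ^ 2) atTop
        (𝓝 (∑ i, tau G γ i / 2 * ‖p' i - p' i‖ ^ 2)) :=
      tendsto_finsetSum _ fun i _ =>
        (((tendsto_pi_nhds.1 hp' i).sub_const (p' i)).norm.pow 2).const_mul _
    have h3 := h1.add h2
    simp only [sub_self, norm_zero, ne_eq, OfNat.ofNat_ne_zero, not_false_eq_true, zero_pow,
      mul_zero, Finset.sum_const_zero, add_zero] at h3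
    exact h3
  have hV := (tendsto_iff_tendsto_subseq_of_antitone hanti hφ.tendsto_atTop).2 hsub
  refine (tendsto_add_atTop_iff_nat 1).1 (tendsto_pi_nhds.2 fun i => ?_)
  have h1 : Tendsto (fun k => x (k + 1) i - z') atTop (𝓝 0) :=
    tendsto_zero_of_mul_norm_sq_le (by have := hc i; positivity)
      (fun k => (mul_norm_sub_sq_le_lyapunov hγ hc z' p' _ _ i).1) hV
  simpa using h1.add_const z'

theorem IsMultiplier.isConsensusOptimal {z : Vec n} {q : Fin N → Vec n}
    (hq : IsMultiplier W ξ f z q) (hW : IsCommunicationMatrix G W) (hG : G.Connected)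
    (hξ : ∀ i, IsClosedConvex (ξ i)) (hz : ∀ i, z ∈ dom (ξ i)) :
    IsConsensusOptimal G ξ f fun _ => z := by
  refine ⟨fun y hy => ?_, fun _ _ _ => rfl⟩
  change totalCost ξ f (fun _ => z) ≤ totalCost ξ f y
  by_cases htop : totalCost ξ f y = ⊤
  · rw [htop]; exact le_top
  have hyd := mem_dom_of_totalCost_ne_top hξ htop
  obtain ⟨i₀⟩ := hG.nonempty
  have hcons : y = fun _ => y i₀ := funext fun i =>
    forall_of_adj hG (P := fun j => y j = y i₀) rfl (fun j k hjk hj => (hy j k hjk).symm.trans hj) i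
  have h1 := hq y hyd
  rw [hcons, hW.blockMap_const] at h1
  simp only [Pi.zero_apply, inner_zero_right, Finset.sum_const_zero, add_zero] at h1
  rw [totalCost_eq_coe hξ (x := fun _ => z) hz, totalCost_eq_coe hξ hyd, EReal.coe_le_coe_iff,
    hcons]
  exact h1

end Convergence

end DPGAW

end

/-! ### The four conclusions -/

theorem mainTheorem5 {n N : ℕ} (G : SimpleGraph (Fin N)) [DecidableRel G.Adj]
    (hG : G.Connected)
    (W : Matrix (Fin N) (Fin N) ℝ) (hW : DPGAW.IsCommunicationMatrix G W)
    -- the private costs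
    (ξ : Fin N → DPGAW.Vec n → EReal) (f : Fin N → DPGAW.Vec n → ℝ)
    (hξ : ∀ i, DPGAW.IsClosedConvex (ξ i))
    (hf : ∀ i, ConvexOn ℝ Set.univ (f i))
    (U : Fin N → Set (DPGAW.Vec n)) (hU : ∀ i, IsOpen (U i))
    (hdomU : ∀ i, DPGAW.dom (ξ i) ⊆ U i)
    (hdiff : ∀ i, DifferentiableOn ℝ (f i) (U i))
    (L : Fin N → NNReal) (hL : ∀ i, LipschitzOnWith (L i) (gradient (f i)) (U i))
    -- a solution of the centralized problem
    (xs : DPGAW.Vec n) (hxs : IsMinOn (DPGAW.centralCost ξ f) Set.univ xs)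
    -- nonempty relative interior of the common domain, and strong duality or Slater's condition
    (hri : (intrinsicInterior ℝ (⋂ i, DPGAW.dom (ξ i))).Nonempty)
    (hdual : DPGAW.HasSaddlePoint W ξ f ∨
      (⋂ i, intrinsicInterior ℝ (DPGAW.dom (ξ i))).Nonempty)
    -- penalties, step sizes and initial points
    (γ c : Fin N → ℝ) (hγ : ∀ i, 0 < γ i) (hc : ∀ i, 0 < c i)
    (hstep : ∀ i, c i * (L i + γ i * DPGAW.colNormSq W i) ≤ 1)
    (x₀ : Fin N → DPGAW.Vec n)
    (hx₀ : ∀ i, ∀ y ∈ DPGAW.dom (ξ i), segment ℝ (x₀ i) y ⊆ U i)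
    -- the run of the algorithm
    (x s p : ℕ → Fin N → DPGAW.Vec n)
    (hrun : DPGAW.IsRun G W ξ f γ c x₀ (fun _ => 0) x s p) :
    -- convergence to an optimal solution
    ((∀ i, c i * (L i + γ i * DPGAW.colNormSq W i) < 1) →
      ∃ x' : Fin N → DPGAW.Vec n, DPGAW.IsConsensusOptimal G ξ f x' ∧
        Filter.Tendsto x Filter.atTop (nhds x')) ∧
    -- upper bound on the suboptimality
    (∀ t : ℕ, 1 ≤ t →
      DPGAW.totalCost ξ f (DPGAW.avg x t) - DPGAW.optValue ξ f ≤
        ((1 / (t : ℝ) * DPGAW.initConst c x₀ xs : ℝ) : EReal)) ∧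
    -- lower bound on the suboptimality and bound on the consensus violation
    (∀ κ : Fin N → ℝ,
      (∀ i, ∀ q ∈ DPGAW.subdiff (DPGAW.localCost (ξ i) (f i)) xs, ‖q‖ ≤ κ i) →
      ∀ t : ℕ, 1 ≤ t →
        ((-(1 / (t : ℝ) * (2 * DPGAW.tauMax G γ / DPGAW.sigmaMin W ^ 2 * ∑ i, κ i ^ 2 +
            DPGAW.initConst c x₀ xs)) : ℝ) : EReal) ≤
          DPGAW.totalCost ξ f (DPGAW.avg x t) - DPGAW.optValue ξ f ∧
        ‖DPGAW.kronApply W (DPGAW.avg x t)‖ ≤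
          1 / (t : ℝ) * (DPGAW.tauMax G γ * (∑ i, κ i ^ 2 / DPGAW.sigmaMin W ^ 2 + 1) +
            DPGAW.initConst c x₀ xs)) ∧
    -- the same rate with the Laplacian in place of `W`
    (fun t : ℕ => ‖DPGAW.kronApply (G.lapMatrix ℝ) (DPGAW.avg x t)‖) =O[Filter.atTop]
      (fun t : ℕ => 1 / (t : ℝ)) := by
  have hne : (⋂ i, DPGAW.dom (ξ i)).Nonempty := hri.mono intrinsicInterior_subset
  have hnei : ∀ i, (DPGAW.dom (ξ i)).Nonempty := fun i => hne.mono (Set.iInter_subset _ i)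
  obtain ⟨hdom, hopt, hmin⟩ := DPGAW.solution_mem_dom_and_le hξ hxs hne
  obtain ⟨q₀, hq₀⟩ : ∃ q, DPGAW.IsMultiplier W ξ f xs q := by
    rcases hdual with h | h
    · exact h.exists_isMultiplier hW hG hξ hdom hmin
    · exact DPGAW.exists_isMultiplier_of_slater hW hG hξ hf hmin h
  have hR := hrun.isDescentRun hW hξ hf hU hdomU hdiff hL hnei hγ hc hx₀
  have hinit : DPGAW.initConst c (x 0) xs = DPGAW.initConst c x₀ xs := by
    rw [funext hrun.x_init]
  have hgap : ∀ t : ℕ, 1 ≤ t → DPGAW.totalCost ξ f (DPGAW.avg x t) - DPGAW.optValue ξ f =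
      ((∑ i, DPGAW.realCost ξ f i (DPGAW.avg x t i) - ∑ i, DPGAW.realCost ξ f i xs : ℝ) :
        EReal) := by
    intro t ht
    rw [hopt, DPGAW.totalCost_eq_coe hξ (hR.avg_mem_dom hξ ht), EReal.coe_sub]
  have hrate : ∀ q, DPGAW.IsMultiplier W ξ f xs q → ∀ ρ : ℝ, 0 ≤ ρ → ∀ t : ℕ, 1 ≤ t →
      ρ * ‖DPGAW.kronApply W (DPGAW.avg x t)‖ ≤ 1 / (t : ℝ) * (DPGAW.initConst c x₀ xs +
        DPGAW.tauMax G γ / 2 *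
          (‖(WithLp.toLp 2 q : PiLp 2 fun _ : Fin N => DPGAW.Vec n)‖ + ρ) ^ 2) := by
    intro q hq ρ hρ t ht
    rw [← hinit]
    exact hR.mul_norm_kronApply_avg_le hW hξ hf hγ hc hstep hdom hq hρ ht
  have hτ : 0 ≤ DPGAW.tauMax G γ := Real.iSup_nonneg fun i => (DPGAW.tau_pos hγ i).le
  refine ⟨fun hlt => ?_, fun t ht => ?_, fun κ hκ t ht => ?_, ?_⟩
  · obtain ⟨z, q, hz, hq, hlim⟩ := hR.exists_tendsto hW hG hξ hf hγ hc hlt hdom hq₀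
    exact ⟨_, hq.isConsensusOptimal hW hG hξ hz, hlim⟩
  · have h1 := hR.lagrangianGap_avg_le hW hξ hf hγ hc hstep hdom 0 ht
    rw [hgap t ht, EReal.coe_le_coe_iff]
    simpa [DPGAW.lagrangianGap, hinit] using h1
  · obtain ⟨q, hq, hqn⟩ := hq₀.exists_norm_sq_le hW hξ hdom hκ
    set Q : PiLp 2 (fun _ : Fin N => DPGAW.Vec n) := WithLp.toLp 2 q with hQ
    have hQn : ‖Q‖ ^ 2 ≤ (∑ i, κ i ^ 2) / DPGAW.sigmaMin W ^ 2 := by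
      rw [PiLp.norm_sq_eq_of_L2]
      exact hqn
    have ht' : (0 : ℝ) < t := by exact_mod_cast ht
    constructor
    · have h1 := hrate q hq ‖Q‖ (norm_nonneg _) t ht
      have h2 := hq _ (hR.avg_mem_dom hξ ht)
      have h3 : ∑ i, inner ℝ (q i) (DPGAW.blockMap W (DPGAW.avg x t) i) ≤
          ‖Q‖ * ‖DPGAW.kronApply W (DPGAW.avg x t)‖ := by
        have := real_inner_le_norm Q (DPGAW.kronApply W (DPGAW.avg x t))
        rwa [PiLp.inner_apply] at this
      have h4 : DPGAW.initConst c x₀ xs + DPGAW.tauMax G γ / 2 * (‖Q‖ + ‖Q‖) ^ 2 ≤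
          2 * DPGAW.tauMax G γ / DPGAW.sigmaMin W ^ 2 * ∑ i, κ i ^ 2 +
            DPGAW.initConst c x₀ xs := by
        have h5 := mul_le_mul_of_nonneg_left hQn (mul_nonneg two_pos.le hτ)
        have h6 : 2 * DPGAW.tauMax G γ * ((∑ i, κ i ^ 2) / DPGAW.sigmaMin W ^ 2) =
            2 * DPGAW.tauMax G γ / DPGAW.sigmaMin W ^ 2 * ∑ i, κ i ^ 2 := by ring
        linarith
      have h7 := mul_le_mul_of_nonneg_left h4 (one_div_pos.2 ht').le
      rw [hgap t ht, EReal.coe_le_coe_iff]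
      linarith
    · have h1 := hrate q hq 1 zero_le_one t ht
      rw [one_mul] at h1
      refine h1.trans (mul_le_mul_of_nonneg_left ?_ (one_div_pos.2 ht').le)
      rw [← Finset.sum_div]
      have h2 : (‖Q‖ + 1) ^ 2 ≤ 2 * ((∑ i, κ i ^ 2) / DPGAW.sigmaMin W ^ 2 + 1) := by
        nlinarith [sq_nonneg (‖Q‖ - 1)]
      have h3 := mul_le_mul_of_nonneg_left h2 hτ
      linarith
  · obtain ⟨C, hC⟩ := hW.exists_norm_lapMatrix_le (n := n) hG
    set K := DPGAW.initConst c x₀ xs + DPGAW.tauMax G γ / 2 *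
      (‖(WithLp.toLp 2 q₀ : PiLp 2 fun _ : Fin N => DPGAW.Vec n)‖ + 1) ^ 2
    refine Asymptotics.IsBigO.of_bound (|C| * K) ?_
    filter_upwards [Filter.eventually_ge_atTop 1] with t ht
    have h1 := hrate q₀ hq₀ 1 zero_le_one t ht
    rw [one_mul] at h1
    rw [norm_norm, Real.norm_of_nonneg (by positivity)]
    calc _ ≤ C * ‖DPGAW.kronApply W (DPGAW.avg x t)‖ := hC _
      _ ≤ |C| * ‖DPGAW.kronApply W (DPGAW.avg x t)‖ :=
        mul_le_mul_of_nonneg_right (le_abs_self C) (norm_nonneg _)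
      _ ≤ |C| * (1 / (t : ℝ) * K) := mul_le_mul_of_nonneg_left h1 (abs_nonneg C)
      _ = |C| * K * (1 / (t : ℝ)) := by ring
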